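/- For $n\ge 0$ let $R_n=\mathbb{C}[x,y,z]/(xz-y^{n+1})$ and $A_n=\operatorname{Spec} R_n=V(xz-y^{n+1})\subset\mathbb{C}^3$, and let $\operatorname{Der}_{\mathbb C}(R_n)$ be the $R_n$-module of $\mathbb{C}$-derivations of $R_n$. For a domain $R$ and a finitely generated $R$-module $M$ of rank $r$, the blow-up of $\operatorname{Spec} R$ along $M$ is a morphism $f\colon \mathrm{Bl}_M(R)\to\operatorname{Spec} R$ from an integral scheme such that $f^*M/\mathrm{tor}$ is locally free of rank $r$ and such that every morphism $\sigma\colon Z\to\operatorname{Spec}R$ from an integral scheme $Z$ with $\sigma^*M/\mathrm{tor}$ locally free of rank $r$ factors uniquely through $f$; it is unique up to unique isomorphism over $\operatorname{Spec} R$. **Theorem.** For every $n\ge 1$ the blow-up $f\colon \mathrm{Bl}_{\operatorname{Der}}A_n\to A_n$ of $A_n$ along $\operatorname{Der}_{\mathbb C}(R_n)$ exists, and it is the following scheme, glued from affine open charts. 1. If $n\ge 3$, the charts are $U_1=\mathbb{C}^2$ with coordinates $(s,t)$, $U_2=A_{n-2}=V(ab-c^{n-1})$ with coordinates $(a,c,b)$,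 and $U_3=\mathbb{C}^2$ with coordinates $(p,q)$. On them $f$ is given by $(x,y,z)=(s,\,st,\,s^nt^{n+1})$, $(x,y,z)=(ac,\,c,\,bc)$ and $(x,y,z)=(p^nq^{n+1},\,pq,\,p)$ respectively. The overlaps are $U_1\cap U_2=\{t\ne0\}\subset U_1$ with $(a,c,b)=(t^{-1},\,st,\,s^{n-1}t^n)$; $U_2\cap U_3=\{q\ne0\}\subset U_3$ with $(a,c,b)=(p^{n-1}q^n,\,pq,\,q^{-1})$; and $U_1\cap U_3=\{st\ne0\}\subset U_1$ with $(p,q)=(s^nt^{n+1},\,s^{1-n}t^{-n})$. 2. If $n=2$, the charts are three copies $U_1,U_2,U_3$ of $\mathbb{C}^2$ with coordinates $(s,t)$, $(a,b)$, $(p,q)$. On them $f$ is given by $(x,y,z)=(s,\,st,\,s^2t^3)$, $(a^2b,\,ab,\,ab^2)$ and $(p^2q^3,\,pq,\,p)$. The overlaps are $U_1\cap U_2=\{t\ne0\}\subset U_1$ with $(a,b)=(t^{-1},\,st^2)$; $U_2\cap U_3=\{q\ne0\}\subset U_3$ with $(a,b)=(pq^2,\,q^{-1})$; and $U_1\cap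 U_3=\{st\ne0\}\subset U_1$ with $(p,q)=(s^2t^3,\,s^{-1}t^{-2})$. 3. If $n=1$, the charts are two copies of $\mathbb{C}^2$ with coordinates $(s,t)$ and $(p,q)$. On them $f$ is given by $(x,y,z)=(s,\,st,\,st^2)$ and $(pq^2,\,pq,\,p)$. The overlap is $\{t\ne0\}$ in the first chart with $(p,q)=(st^2,\,t^{-1})$. In particular, for $n=1$ and $n=2$ the scheme $\mathrm{Bl}_{\operatorname{Der}}A_n$ is smooth over $\mathbb{C}$. -/

import Mathlib

open CategoryTheory AlgebraicGeometry TensorProduct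

noncomputable section

/-! ### Blow-up of an affine scheme along a module -/

/-- For a ring homomorphism `φ : R → B` and an `R`-module `M`, the `B`-module
`(B ⊗_R M) / torsion` is free of rank `r`. -/
def FreeModTorsion {R B : Type} [CommRing R] [CommRing B] (φ : R →+* B)
    (M : Type) [AddCommGroup M] [Module R M] (r : ℕ) : Prop :=
  letI := φ.toAlgebra
  Nonempty (((B ⊗[R] M) ⧸ Submodule.torsion B (B ⊗[R] M)) ≃ₗ[B] (Fin r → B))

/-- The ring homomorphism `R → Γ(Z, U)` induced by a morphism `σ : Z ⟶ Spec R`. -/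
def toSections {R : Type} [CommRing R] {Z : Scheme.{0}} (σ : Z ⟶ Spec (CommRingCat.of R))
    (U : Z.Opens) : R →+* Γ(Z, U) :=
  ((Scheme.ΓSpecIso (CommRingCat.of R)).inv ≫ σ.appLE ⊤ U le_top).hom

/-- For an integral scheme `Z`, a morphism `σ : Z ⟶ Spec R` and a finitely generated `R`-module
`M`: the sheaf `σ^* M / tor` is locally free of rank `r`. On an affine open `U` of `Z` the sheaf
`σ^* M / tor` is the quasi-coherent sheaf of the module `(Γ(Z, U) ⊗_R M) / torsion`. -/
def PullbackModTorsionLocallyFree {R : Type} [CommRing R] (M : Type) [AddCommGroup M] [Module R M]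
    {Z : Scheme.{0}} (σ : Z ⟶ Spec (CommRingCat.of R)) (r : ℕ) : Prop :=
  ∀ z : Z, ∃ U : Z.Opens, IsAffineOpen U ∧ z ∈ U ∧ FreeModTorsion (toSections σ U) M r

/-- `f : X ⟶ Spec R` is the blow-up of (the spectrum of) the domain `R` along the finitely
generated `R`-module `M`, whose rank is `Module.finrank R M`: `X` is integral, `f^* M / tor` is
locally free of rank `rank M`, and `f` is universal with this property among integral schemes. -/
structure IsModuleBlowUp {R : Type} [CommRing R] (M : Type) [AddCommGroup M] [Module R M]
    {X : Scheme.{0}} (f : X ⟶ Spec (CommRingCat.of R)) : Prop where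
  isIntegral : AlgebraicGeometry.IsIntegral X
  locallyFree : PullbackModTorsionLocallyFree M f (Module.finrank R M)
  existsUnique_lift : ∀ (Z : Scheme.{0}) [AlgebraicGeometry.IsIntegral Z] (σ : Z ⟶ Spec (CommRingCat.of R)),
    PullbackModTorsionLocallyFree M σ (Module.finrank R M) → ∃! β : Z ⟶ X, β ≫ f = σ

/-! ### Gluing -/

/-- `X` is the scheme glued from `U₁` and `U₂` along the common open subscheme
`U₁ ⟵ V ⟶ U₂`. -/
structure IsGluingOfTwo {X U₁ U₂ V : Scheme.{0}} (j₁ : U₁ ⟶ X) (j₂ : U₂ ⟶ X)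
    (a₁ : V ⟶ U₁) (a₂ : V ⟶ U₂) : Prop where
  isOpenImmersion₁ : IsOpenImmersion j₁
  isOpenImmersion₂ : IsOpenImmersion j₂
  cover : ∀ x : X, x ∈ Set.range j₁ ∨ x ∈ Set.range j₂
  overlap : IsPullback a₁ a₂ j₁ j₂

/-- `X` is the scheme glued from `U₁`, `U₂` and `U₃` along the common open subschemes
`U₁ ⟵ V₁₂ ⟶ U₂`, `U₂ ⟵ V₂₃ ⟶ U₃` and `U₁ ⟵ V₁₃ ⟶ U₃`. -/
structure IsGluingOfThree {X U₁ U₂ U₃ V₁₂ V₂₃ V₁₃ : Scheme.{0}}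
    (j₁ : U₁ ⟶ X) (j₂ : U₂ ⟶ X) (j₃ : U₃ ⟶ X)
    (a₁ : V₁₂ ⟶ U₁) (a₂ : V₁₂ ⟶ U₂) (b₂ : V₂₃ ⟶ U₂) (b₃ : V₂₃ ⟶ U₃)
    (c₁ : V₁₃ ⟶ U₁) (c₃ : V₁₃ ⟶ U₃) : Prop where
  isOpenImmersion₁ : IsOpenImmersion j₁
  isOpenImmersion₂ : IsOpenImmersion j₂
  isOpenImmersion₃ : IsOpenImmersion j₃
  cover : ∀ x : X, x ∈ Set.range j₁ ∨ x ∈ Set.range j₂ ∨ x ∈ Set.range j₃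
  overlap₁₂ : IsPullback a₁ a₂ j₁ j₂
  overlap₂₃ : IsPullback b₂ b₃ j₂ j₃
  overlap₁₃ : IsPullback c₁ c₃ j₁ j₃

/-! ### The surface `A_n` and the affine plane -/

namespace ASing

open MvPolynomial

/-- `ℂ[x, y, z] / (x z - y ^ (n + 1))`, with `x = X 0`, `y = X 1`, `z = X 2`. -/
abbrev SurfaceRing (n : ℕ) : Type :=
  MvPolynomial (Fin 3) ℂ ⧸
    Ideal.span {(X 0 * X 2 - X 1 ^ (n + 1) : MvPolynomial (Fin 3) ℂ)}

/-- The coordinate ring of `ℂ²`. -/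
abbrev PlaneRing : Type := MvPolynomial (Fin 2) ℂ

/-- The toric surface `A_n = V(x z - y ^ (n + 1)) ⊆ ℂ³`. -/
abbrev Surface (n : ℕ) : Scheme.{0} := Spec (CommRingCat.of (SurfaceRing n))

/-- The affine plane `ℂ²`. -/
abbrev Plane : Scheme.{0} := Spec (CommRingCat.of PlaneRing)

/-- The structure morphism `A_n ⟶ Spec ℂ`. -/
def surfaceToBase (n : ℕ) : Surface n ⟶ Spec (CommRingCat.of ℂ) :=
  Spec.map (CommRingCat.ofHom (algebraMap ℂ (SurfaceRing n)))

/-- The `ℂ`-algebra homomorphism out of the coordinate ring of `A_n` with prescribed values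
of `x`, `y`, `z`. -/
def surfaceLift (n : ℕ) {B : Type} [CommRing B] [Algebra ℂ B] (x y z : B)
    (h : x * z = y ^ (n + 1)) : SurfaceRing n →ₐ[ℂ] B :=
  Ideal.Quotient.liftₐ _ (aeval ![x, y, z]) (by
    intro p hp
    have hle : Ideal.span {(X 0 * X 2 - X 1 ^ (n + 1) : MvPolynomial (Fin 3) ℂ)} ≤
        RingHom.ker (aeval ![x, y, z] : MvPolynomial (Fin 3) ℂ →ₐ[ℂ] B) := by
      rw [Ideal.span_singleton_le_iff_mem, RingHom.mem_ker]
      simp [h]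
    exact hle hp)

/-- The coordinate function `x`, `y`, `z` of `A_n` for `i = 0`, `1`, `2`. -/
def coord (n : ℕ) (i : Fin 3) : SurfaceRing n := Ideal.Quotient.mk _ (X i)

theorem surfaceLift_coord (n : ℕ) {B : Type} [CommRing B] [Algebra ℂ B] (x y z : B)
    (h : x * z = y ^ (n + 1)) (i : Fin 3) :
    surfaceLift n x y z h (coord n i) = ![x, y, z] i := by
  simp only [surfaceLift, coord]
  erw [Ideal.Quotient.lift_mk]
  simp

theorem coord_relation (n : ℕ) : coord n 0 * coord n 2 = coord n 1 ^ (n + 1) := by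
  simp only [coord, ← map_mul, ← map_pow]
  exact (Ideal.Quotient.mk_eq_mk_iff_sub_mem _ _).2 (Ideal.mem_span_singleton_self _)

/-- The morphism of affine schemes of a homomorphism of `ℂ`-algebras. -/
abbrev specMap {A B : Type} [CommRing A] [CommRing B] [Algebra ℂ A] [Algebra ℂ B]
    (φ : A →ₐ[ℂ] B) : Spec (CommRingCat.of B) ⟶ Spec (CommRingCat.of A) :=
  Spec.map (CommRingCat.ofHom φ.toRingHom)

/-! ### Restrictions of the blow-up morphism to the charts -/

/-- `x = s`, `y = s t`, `z = s ^ n t ^ (n + 1)`, where `s = X 0`, `t = X 1`. -/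
def chartFirst (n : ℕ) : SurfaceRing n →ₐ[ℂ] PlaneRing :=
  surfaceLift n (X 0) (X 0 * X 1) (X 0 ^ n * X 1 ^ (n + 1)) (by ring)

/-- `x = p ^ n q ^ (n + 1)`, `y = p q`, `z = p`, where `p = X 0`, `q = X 1`. -/
def chartLast (n : ℕ) : SurfaceRing n →ₐ[ℂ] PlaneRing :=
  surfaceLift n (X 0 ^ n * X 1 ^ (n + 1)) (X 0 * X 1) (X 0) (by ring)

/-- `x = a c`, `y = c`, `z = b c`, where `a`, `c`, `b` are the coordinates of `A_{n-2}`,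
with `a b = c ^ (n - 1)`. -/
def chartMiddle (n : ℕ) (hn : 2 ≤ n) : SurfaceRing n →ₐ[ℂ] SurfaceRing (n - 2) :=
  surfaceLift n (coord (n - 2) 0 * coord (n - 2) 1) (coord (n - 2) 1)
    (coord (n - 2) 2 * coord (n - 2) 1) (by
      have h := coord_relation (n - 2)
      have e : coord (n - 2) 1 ^ (n + 1) = coord (n - 2) 1 ^ (n - 2 + 1) * coord (n - 2) 1 ^ 2 := by
        rw [← pow_add]; congr 1; omega
      rw [e, ← h]; ring)

/-- `x = a² b`, `y = a b`, `z = a b²`, where `a = X 0`, `b = X 1`. -/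
def chartMiddleTwo : SurfaceRing 2 →ₐ[ℂ] PlaneRing :=
  surfaceLift 2 (X 0 ^ 2 * X 1) (X 0 * X 1) (X 0 * X 1 ^ 2) (by ring)

/-! ### Overlaps -/

/-- The coordinate ring `ℂ[s, t, 1/g]` of the principal open subset `{g ≠ 0}` of `ℂ²`. -/
abbrev PlaneAway (g : PlaneRing) : Type := Localization.Away g

/-- The function `1/g` on `{g ≠ 0}`. -/
abbrev invFn (g : PlaneRing) : PlaneAway g := IsLocalization.Away.invSelf g

/-- The regular function on `{g ≠ 0}` given by a polynomial. -/
abbrev resFn (g p : PlaneRing) : PlaneAway g := algebraMap PlaneRing (PlaneAway g) p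

/-- The inclusion `{g ≠ 0} ⟶ ℂ²`. -/
def principalOpenIncl (g : PlaneRing) : Spec (CommRingCat.of (PlaneAway g)) ⟶ Plane :=
  specMap (IsScalarTower.toAlgHom ℂ PlaneRing (PlaneAway g))

/-- `a = 1/t`, `c = s t`, `b = s ^ (n - 1) t ^ n` on `{t ≠ 0}`. -/
def overlapFirstMiddle (n : ℕ) (hn : 2 ≤ n) :
    SurfaceRing (n - 2) →ₐ[ℂ] PlaneAway (X 1) :=
  surfaceLift (n - 2) (invFn (X 1)) (resFn (X 1) (X 0 * X 1))
    (resFn (X 1) (X 0 ^ (n - 1) * X 1 ^ n)) (by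
      obtain ⟨m, rfl⟩ := Nat.exists_eq_add_of_le' hn
      have h := IsLocalization.Away.mul_invSelf (S := PlaneAway (X 1)) (X 1 : PlaneRing)
      simp only [resFn, invFn, map_mul, map_pow] at h ⊢
      rw [show m + 2 - 1 = m + 1 from rfl, show m + 2 - 2 + 1 = m + 1 from rfl,
        pow_succ _ (m + 1), mul_pow]
      linear_combination
        (algebraMap PlaneRing (PlaneAway (X 1)) (X 0)) ^ (m + 1) *
          (algebraMap PlaneRing (PlaneAway (X 1)) (X 1)) ^ (m + 1) * h)

/-- `a = p ^ (n - 1) q ^ n`, `c = p q`, `b = 1/q` on `{q ≠ 0}`. -/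
def overlapLastMiddle (n : ℕ) (hn : 2 ≤ n) :
    SurfaceRing (n - 2) →ₐ[ℂ] PlaneAway (X 1) :=
  surfaceLift (n - 2) (resFn (X 1) (X 0 ^ (n - 1) * X 1 ^ n)) (resFn (X 1) (X 0 * X 1))
    (invFn (X 1)) (by
      obtain ⟨m, rfl⟩ := Nat.exists_eq_add_of_le' hn
      have h := IsLocalization.Away.mul_invSelf (S := PlaneAway (X 1)) (X 1 : PlaneRing)
      simp only [resFn, invFn, map_mul, map_pow] at h ⊢
      rw [show m + 2 - 1 = m + 1 from rfl, show m + 2 - 2 + 1 = m + 1 from rfl,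
        pow_succ _ (m + 1), mul_pow]
      linear_combination
        (algebraMap PlaneRing (PlaneAway (X 1)) (X 0)) ^ (m + 1) *
          (algebraMap PlaneRing (PlaneAway (X 1)) (X 1)) ^ (m + 1) * h)

/-- `p = s ^ n t ^ (n + 1)`, `q = s ^ (1 - n) t ^ (- n) = s / (s t) ^ n` on `{s t ≠ 0}`. -/
def overlapFirstLast (n : ℕ) : PlaneRing →ₐ[ℂ] PlaneAway (X 0 * X 1) :=
  aeval ![resFn (X 0 * X 1) (X 0 ^ n * X 1 ^ (n + 1)),
    resFn (X 0 * X 1) (X 0) * invFn (X 0 * X 1) ^ n]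

/-- `a = 1/t`, `b = s t²` on `{t ≠ 0}`. -/
def overlapFirstMiddleTwo : PlaneRing →ₐ[ℂ] PlaneAway (X 1) :=
  aeval ![invFn (X 1), resFn (X 1) (X 0 * X 1 ^ 2)]

/-- `a = p q²`, `b = 1/q` on `{q ≠ 0}`. -/
def overlapLastMiddleTwo : PlaneRing →ₐ[ℂ] PlaneAway (X 1) :=
  aeval ![resFn (X 1) (X 0 * X 1 ^ 2), invFn (X 1)]

/-- `p = s t²`, `q = 1/t` on `{t ≠ 0}`. -/
def overlapFirstLastOne : PlaneRing →ₐ[ℂ] PlaneAway (X 1) :=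
  aeval ![resFn (X 1) (X 0 * X 1 ^ 2), invFn (X 1)]

/-- `f : X ⟶ A_n` is the blow-up of `A_n` along its module of `ℂ`-derivations. -/
def IsDerBlowUp (n : ℕ) {X : Scheme.{0}} (f : X ⟶ Surface n) : Prop :=
  IsModuleBlowUp (R := SurfaceRing n) (Derivation ℂ (SurfaceRing n) (SurfaceRing n)) f

end ASing

end

noncomputable section

namespace ASing

open MvPolynomial

/-! ### The surface ring -/

/-! The module Der(R_n) is generated by D₁ = (n+1)x∂x + y∂y, D₂ = (n+1)yⁿ∂x + z∂y, D₃ = x∂y +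
(n+1)yⁿ∂z and D₄ = y∂y + (n+1)z∂z (`exists_der_eq`). The first two kill z, the last two kill x, and
the relations yD₂ = zD₁, xD₂ = yⁿD₁, yD₃ = xD₄, zD₃ = yⁿD₄ make D₁, D₂ proportional and D₃, D₄
proportional. Generically D₂/D₁ = z/y = yⁿ/x and D₃/D₄ = x/y = yⁿ/z. The pullback modulo torsion is
therefore free of rank 2 as soon as one of D₁, D₂ and one of D₃, D₄ generate. The pair (D₁, D₃)
gives the chart t = y/x, the pair (D₂, D₄) the chart q = y/z, and (D₁, D₄) the chart a = x/y, c = y,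
b = z/y, where ab = cⁿ⁻¹. The pair (D₂, D₃) gives nothing new: it leads to the first chart again.

Existence of local lifts: if the pullback is free of rank 2, the 2×2 minors of the four generators
span the unit ideal. The minors of (D₁, D₂) and (D₃, D₄) vanish, so locally one of the other four is
invertible, and ratios of minors are the missing chart coordinates
(`exists_minors_of_freeModTorsion`, `exists_local_lift`). This needs the generic point to avoid the
singular point. At that point the fibre of Der has dimension greater than 2
(`exists_coord_ne_zero_of_freeModTorsion`).

Uniqueness and overlaps both rest on `SeparatedBy`: two maps from an integral scheme to charts that
agree on the surface and are not generically singular factor through the prescribed overlap. This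
forces local lifts to agree, so that they glue, and shows that the overlap squares are cartesian.
The universal property then holds for any scheme covered by such charts (`isDerBlowUp_of_charts`).
Such a scheme is built by successive gluing, and `IsModuleBlowUp.exists_iso` transports its charts
to an arbitrary blow-up. -/

theorem prime_surfaceEquation (n : ℕ) :
    Prime (X 0 * X 2 - X 1 ^ (n + 1) : MvPolynomial (Fin 3) ℂ) := by
  have h : Irreducible (X 2 * X 0 + -(X 1 ^ (n + 1)) : MvPolynomial (Fin 3) ℂ) := by
    -- The equation is linear in x, and its coefficients z and -yⁿ⁺¹ do not involve x and are
    -- relatively prime.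
    refine irreducible_mul_X_add _ _ 0 (X_ne_zero 2) (by simp [vars_X]) ?_ ?_
    · rw [vars_neg]
      exact fun h => by simpa [vars_X] using vars_pow _ _ h
    · refine IsRelPrime.neg_right (IsRelPrime.pow_right ?_)
      refine ((X_prime (R := ℂ) (i := (2 : Fin 3))).irreducible.isRelPrime_iff_not_dvd).2 ?_
      rw [X_dvd_X]
      simp
  have := h.prime
  rwa [show (X 2 * X 0 + -(X 1 ^ (n + 1)) : MvPolynomial (Fin 3) ℂ) =
    X 0 * X 2 - X 1 ^ (n + 1) by ring] at this

instance surfaceRing_isDomain (n : ℕ) : IsDomain (SurfaceRing n) := by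
  rw [Ideal.Quotient.isDomain_iff_prime,
    Ideal.span_singleton_prime (prime_surfaceEquation n).ne_zero]
  exact prime_surfaceEquation n

theorem surfaceRing_algHom_ext {n : ℕ} {B : Type} [CommRing B] [Algebra ℂ B]
    {f g : SurfaceRing n →ₐ[ℂ] B} (h : ∀ i, f (coord n i) = g (coord n i)) : f = g := by
  apply Ideal.Quotient.algHom_ext
  apply MvPolynomial.algHom_ext
  exact h

theorem coord_ne_zero (n : ℕ) (i : Fin 3) : coord n i ≠ 0 := by
  intro h
  have h' := congrArg (chartFirst n) h
  rw [chartFirst, surfaceLift_coord, map_zero] at h'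
  fin_cases i <;> simp at h'

theorem sub_aeval_mem {σ : Type} (φ : MvPolynomial σ ℂ →ₐ[ℂ] MvPolynomial σ ℂ)
    (I : Ideal (MvPolynomial σ ℂ)) (h : ∀ i, X i - φ (X i) ∈ I) (p : MvPolynomial σ ℂ) :
    p - φ p ∈ I := by
  rw [← Ideal.Quotient.mk_eq_mk_iff_sub_mem]
  refine DFunLike.congr_fun (f := Ideal.Quotient.mkₐ ℂ I)
    (g := (Ideal.Quotient.mkₐ ℂ I).comp φ) (MvPolynomial.algHom_ext fun i => ?_) p
  exact (Ideal.Quotient.mk_eq_mk_iff_sub_mem _ _).2 (h i)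

theorem exists_algHom_X (v : Fin 3 → MvPolynomial (Fin 3) ℂ) :
    ∃ φ : MvPolynomial (Fin 3) ℂ →ₐ[ℂ] MvPolynomial (Fin 3) ℂ, ∀ i, φ (X i) = v i :=
  ⟨aeval v, aeval_X v⟩

/-- Modulo x and z the surface ring becomes ℂ[y]/(yⁿ⁺¹), where yⁿb = 0 forces y to divide b. -/
theorem mem_coord_span_of_smul_mem {n : ℕ} {b : SurfaceRing n}
    (h : ∃ a c, coord n 1 ^ n * b = coord n 0 * a + coord n 2 * c) :
    ∃ b₀ b₁ b₂, b = coord n 0 * b₀ + coord n 1 * b₁ + coord n 2 * b₂ := by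
  obtain ⟨a, c, h⟩ := h
  obtain ⟨a, rfl⟩ := Ideal.Quotient.mk_surjective a
  obtain ⟨b, rfl⟩ := Ideal.Quotient.mk_surjective b
  obtain ⟨c, rfl⟩ := Ideal.Quotient.mk_surjective c
  simp only [coord, ← map_mul, ← map_pow, ← map_add] at h
  obtain ⟨e, he⟩ := Ideal.mem_span_singleton'.1 ((Ideal.Quotient.mk_eq_mk_iff_sub_mem _ _).1 h)
  -- φ sets x = z = 0; it turns the lifted equation into -yⁿ⁺¹φ(e) = yⁿφ(b), from which yⁿ cancels.
  obtain ⟨φ, hφX⟩ := exists_algHom_X ![0, X 1, 0]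
  have hφ : b - φ b ∈ Ideal.span {(X 0 : MvPolynomial (Fin 3) ℂ), X 2} := by
    refine sub_aeval_mem φ _ (fun i => ?_) b
    rw [hφX]
    fin_cases i
    · simpa using Ideal.subset_span (by simp)
    · simp
    · simpa using Ideal.subset_span (by simp)
  obtain ⟨u, v, huv⟩ := Ideal.mem_span_pair.1 hφ
  have he' := congrArg φ he
  simp only [map_mul, map_sub, map_pow, map_add, hφX] at he'
  simp at he'
  have hb : φ b = -(X 1 * φ e) := by
    have h1 : (X 1 ^ n : MvPolynomial (Fin 3) ℂ) ≠ 0 := pow_ne_zero _ (X_ne_zero 1)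
    apply mul_left_cancel₀ h1
    linear_combination -he'
  refine ⟨Ideal.Quotient.mk _ u, Ideal.Quotient.mk _ (-φ e), Ideal.Quotient.mk _ v, ?_⟩
  simp only [coord, ← map_mul, ← map_add]
  congr 1
  linear_combination -huv + hb

/-- The pair x, z is a regular sequence: the quotient by x is ℂ[y, z]/(yⁿ⁺¹), in which z is not a
zero divisor. So only Koszul syzygies occur. -/
theorem dvd_of_coord_mul_add_eq_zero {n : ℕ} {a c : SurfaceRing n}
    (h : coord n 2 * a + coord n 0 * c = 0) :
    ∃ d, a = coord n 0 * d ∧ c = - (coord n 2 * d) := by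
  suffices hd : ∃ d, a = coord n 0 * d by
    obtain ⟨d, rfl⟩ := hd
    refine ⟨d, rfl, mul_left_cancel₀ (coord_ne_zero n 0) ?_⟩
    linear_combination h
  obtain ⟨a, rfl⟩ := Ideal.Quotient.mk_surjective a
  obtain ⟨c, rfl⟩ := Ideal.Quotient.mk_surjective c
  simp only [coord, ← map_mul, ← map_add] at h
  obtain ⟨e, he⟩ := Ideal.mem_span_singleton'.1 (Ideal.Quotient.eq_zero_iff_mem.1 h)
  obtain ⟨φ, hφX⟩ := exists_algHom_X ![0, X 1, X 2]
  have hφ : a - φ a ∈ Ideal.span {(X 0 : MvPolynomial (Fin 3) ℂ)} := by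
    refine sub_aeval_mem φ _ (fun i => ?_) a
    rw [hφX]
    fin_cases i
    all_goals simp
  obtain ⟨u, hu⟩ := Ideal.mem_span_singleton'.1 hφ
  have he' := congrArg φ he
  simp only [map_mul, map_sub, map_pow, map_add, hφX] at he'
  simp at he'
  -- With x = 0 the equation reads -yⁿ⁺¹φ(e) = zφ(a), and the prime z does not divide y.
  have h2 : (X 2 : MvPolynomial (Fin 3) ℂ) ∣ φ e := by
    have hp : Prime (X 2 : MvPolynomial (Fin 3) ℂ) := X_prime
    have : (X 2 : MvPolynomial (Fin 3) ℂ) ∣ φ e * X 1 ^ (n + 1) :=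
      ⟨-φ a, by linear_combination -he'⟩
    refine (hp.dvd_or_dvd this).resolve_right fun h => ?_
    have := hp.dvd_of_dvd_pow h
    rw [X_dvd_X] at this
    simp at this
  obtain ⟨w, hw⟩ := h2
  have ha : φ a = -(X 1 ^ (n + 1) * w) := by
    have h1 : (X 2 : MvPolynomial (Fin 3) ℂ) ≠ 0 := X_ne_zero 2
    apply mul_left_cancel₀ h1
    linear_combination -he' - X 1 ^ (n + 1) * hw
  have hq : Ideal.Quotient.mk _ a = coord n 0 * Ideal.Quotient.mk _ u
      - coord n 1 ^ (n + 1) * Ideal.Quotient.mk _ w := by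
    simp only [coord, ← map_mul, ← map_pow, ← map_sub]
    congr 1
    linear_combination -hu + ha
  refine ⟨Ideal.Quotient.mk _ u - coord n 2 * Ideal.Quotient.mk _ w, ?_⟩
  rw [hq, ← coord_relation]
  ring

/-! ### Derivations of the surface ring -/

/-- The module of derivations of the surface ring. -/
abbrev Der (n : ℕ) : Type := Derivation ℂ (SurfaceRing n) (SurfaceRing n)

theorem der_ext {n : ℕ} {D D' : Der n} (h : ∀ i, D (coord n i) = D' (coord n i)) : D = D' := by
  ext p
  obtain ⟨p, rfl⟩ := Ideal.Quotient.mk_surjective p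
  have : (D.compAlgebraMap (MvPolynomial (Fin 3) ℂ)) = D'.compAlgebraMap (MvPolynomial (Fin 3) ℂ) :=
    MvPolynomial.derivation_ext h
  exact DFunLike.congr_fun this p

theorem der_relation {n : ℕ} (D : Der n) :
    coord n 2 * D (coord n 0) + coord n 0 * D (coord n 2) =
      (n + 1) * (coord n 1 ^ n * D (coord n 1)) := by
  have h := congrArg D (coord_relation n)
  simp only [Derivation.leibniz, Derivation.leibniz_pow, smul_eq_mul, nsmul_eq_mul] at h
  push_cast at h
  linear_combination h

/-- A derivation of the polynomial ring descends once it sends the ideal of the surface into itself.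
By the Leibniz rule this needs checking only on the defining equation, which is the hypothesis on v.
-/
theorem exists_der (n : ℕ) (v : Fin 3 → SurfaceRing n)
    (h : coord n 2 * v 0 + coord n 0 * v 2 = (n + 1) * (coord n 1 ^ n * v 1)) :
    ∃ D : Der n, ∀ i, D (coord n i) = v i := by
  choose w hw using fun i => Ideal.Quotient.mk_surjective (v i)
  let π := Ideal.Quotient.mkₐ ℂ
    (Ideal.span {(X 0 * X 2 - X 1 ^ (n + 1) : MvPolynomial (Fin 3) ℂ)})
  let d : Derivation ℂ (MvPolynomial (Fin 3) ℂ) (MvPolynomial (Fin 3) ℂ) := mkDerivation ℂ w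
  have hdf : π (d (X 0 * X 2 - X 1 ^ (n + 1))) = 0 := by
    simp only [map_sub, Derivation.leibniz, Derivation.leibniz_pow, d, mkDerivation_X,
      smul_eq_mul, nsmul_eq_mul, map_add, map_mul, map_pow, map_natCast]
    simp only [π, Ideal.Quotient.mkₐ_eq_mk, hw]
    change coord n 0 * v 2 + coord n 2 * v 0 - _ * (coord n 1 ^ _ * v 1) = 0
    push_cast
    linear_combination h
  have hd : ∀ p, π p = 0 → π (d p) = 0 := by
    intro p hp
    obtain ⟨q, rfl⟩ := Ideal.mem_span_singleton'.1 (Ideal.Quotient.eq_zero_iff_mem.1 hp)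
    have hf : π (X 0 * X 2 - X 1 ^ (n + 1)) = 0 :=
      Ideal.Quotient.eq_zero_iff_mem.2 (Ideal.mem_span_singleton_self _)
    simp only [Derivation.leibniz, smul_eq_mul, map_add, map_mul, hdf, hf]
    ring
  have hπ : Function.Surjective π := Ideal.Quotient.mk_surjective
  refine ⟨d.liftOfSurjective hπ hd, fun i => ?_⟩
  refine (Derivation.liftOfSurjective_apply hπ hd (X i)).trans ?_
  simp only [d, mkDerivation_X]
  exact hw i

end ASing
end

noncomputable section

namespace ASing

open MvPolynomial

/-! ### Generators of the module of derivations -/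

theorem exists_derXY (n : ℕ) : ∃ D : Der n,
    ∀ i, D (coord n i) = ![(n + 1) * coord n 0, coord n 1, 0] i := by
  refine exists_der n _ ?_
  have h := coord_relation n
  simp
  linear_combination (n + 1 : SurfaceRing n) * h

theorem exists_derYZ (n : ℕ) : ∃ D : Der n,
    ∀ i, D (coord n i) = ![0, coord n 1, (n + 1) * coord n 2] i := by
  refine exists_der n _ ?_
  have h := coord_relation n
  simp
  linear_combination (n + 1 : SurfaceRing n) * h

theorem exists_derToZ (n : ℕ) : ∃ D : Der n,
    ∀ i, D (coord n i) = ![(n + 1) * coord n 1 ^ n, coord n 2, 0] i := by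
  refine exists_der n _ ?_
  simp
  ring

theorem exists_derToX (n : ℕ) : ∃ D : Der n,
    ∀ i, D (coord n i) = ![0, coord n 0, (n + 1) * coord n 1 ^ n] i := by
  refine exists_der n _ ?_
  simp
  ring

/-- The derivation `(n + 1) x ∂/∂x + y ∂/∂y`. -/
def derXY (n : ℕ) : Der n := (exists_derXY n).choose

/-- The derivation `y ∂/∂y + (n + 1) z ∂/∂z`. -/
def derYZ (n : ℕ) : Der n := (exists_derYZ n).choose

/-- The derivation `(n + 1) y ^ n ∂/∂x + z ∂/∂y`. -/
def derToZ (n : ℕ) : Der n := (exists_derToZ n).choose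

/-- The derivation `x ∂/∂y + (n + 1) y ^ n ∂/∂z`. -/
def derToX (n : ℕ) : Der n := (exists_derToX n).choose

@[simp]
theorem derXY_coord (n : ℕ) (i : Fin 3) :
    derXY n (coord n i) = ![(n + 1) * coord n 0, coord n 1, 0] i :=
  (exists_derXY n).choose_spec i

@[simp]
theorem derYZ_coord (n : ℕ) (i : Fin 3) :
    derYZ n (coord n i) = ![0, coord n 1, (n + 1) * coord n 2] i :=
  (exists_derYZ n).choose_spec i

@[simp]
theorem derToZ_coord (n : ℕ) (i : Fin 3) :
    derToZ n (coord n i) = ![(n + 1) * coord n 1 ^ n, coord n 2, 0] i :=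
  (exists_derToZ n).choose_spec i

@[simp]
theorem derToX_coord (n : ℕ) (i : Fin 3) :
    derToX n (coord n i) = ![0, coord n 0, (n + 1) * coord n 1 ^ n] i :=
  (exists_derToX n).choose_spec i

theorem y_smul_derToZ (n : ℕ) : coord n 1 • derToZ n = coord n 2 • derXY n := by
  have h := coord_relation n
  refine der_ext fun i => ?_
  fin_cases i <;> simp
  · linear_combination - (n + 1 : SurfaceRing n) * h
  · ring

theorem x_smul_derToZ (n : ℕ) : coord n 0 • derToZ n = coord n 1 ^ n • derXY n := by
  have h := coord_relation n
  refine der_ext fun i => ?_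
  fin_cases i <;> simp
  · ring
  · linear_combination h

theorem y_smul_derToX (n : ℕ) : coord n 1 • derToX n = coord n 0 • derYZ n := by
  have h := coord_relation n
  refine der_ext fun i => ?_
  fin_cases i <;> simp
  · ring
  · linear_combination - (n + 1 : SurfaceRing n) * h

theorem z_smul_derToX (n : ℕ) : coord n 2 • derToX n = coord n 1 ^ n • derYZ n := by
  have h := coord_relation n
  refine der_ext fun i => ?_
  fin_cases i <;> simp
  · linear_combination h
  · ring

theorem add_one_mul_algebraMap_inv (n : ℕ) :
    (n + 1 : SurfaceRing n) * algebraMap ℂ _ (n + 1 : ℂ)⁻¹ = 1 := by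
  have h := congrArg (algebraMap ℂ (SurfaceRing n))
    (mul_inv_cancel₀ (Nat.cast_add_one_ne_zero (R := ℂ) n))
  simpa only [map_mul, map_add, map_natCast, map_one] using h

theorem add_one_ne_zero_surfaceRing (n : ℕ) : (n + 1 : SurfaceRing n) ≠ 0 :=
  left_ne_zero_of_mul_eq_one (add_one_mul_algebraMap_inv n)

/-- Differentiating xz = yⁿ⁺¹ shows yⁿD(y) ∈ (x, z), because n + 1 is invertible in ℂ; hence D(y)
lies in (x, y, z). -/
theorem der_y_mem (n : ℕ) (D : Der n) : ∃ b₀ b₁ b₂,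
    D (coord n 1) = coord n 0 * b₀ + coord n 1 * b₁ + coord n 2 * b₂ := by
  refine mem_coord_span_of_smul_mem
    ⟨algebraMap ℂ _ (n + 1 : ℂ)⁻¹ * D (coord n 2), algebraMap ℂ _ (n + 1 : ℂ)⁻¹ * D (coord n 0), ?_⟩
  apply mul_left_cancel₀ (add_one_ne_zero_surfaceRing n)
  rw [← der_relation]
  have h := add_one_mul_algebraMap_inv n
  linear_combination
    -(coord n 2 * D (coord n 0) + coord n 0 * D (coord n 2)) * h

/-- Since `derToX`, `derXY` and `derToZ` send y to x, y and z, a combination of them matches D on y.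
The remainder kills y, so the Koszul syzygy makes it a multiple d(x∂x - z∂z), and (n+1)(x∂x - z∂z)
is `derXY` minus `derYZ`. -/
theorem exists_der_eq (n : ℕ) (D : Der n) : ∃ r₁ r₂ r₃ r₄ : SurfaceRing n,
    D = r₁ • derXY n + r₂ • derToZ n + r₃ • derToX n + r₄ • derYZ n := by
  obtain ⟨b₀, b₁, b₂, hb⟩ := der_y_mem n D
  obtain ⟨d, hd₀, hd₂⟩ := dvd_of_coord_mul_add_eq_zero (n := n)
    (a := (D - b₀ • derToX n - b₁ • derXY n - b₂ • derToZ n) (coord n 0))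
    (c := (D - b₀ • derToX n - b₁ • derXY n - b₂ • derToZ n) (coord n 2)) (by
      rw [der_relation]
      simp
      right; right
      linear_combination hb)
  have h := add_one_mul_algebraMap_inv n
  refine ⟨b₁ + algebraMap ℂ _ (n + 1 : ℂ)⁻¹ * d, b₂, b₀, -(algebraMap ℂ _ (n + 1 : ℂ)⁻¹ * d),
    der_ext fun i => ?_⟩
  simp at hd₀ hd₂
  fin_cases i <;> simp
  · linear_combination hd₀ - coord n 0 * d * h
  · linear_combination hb
  · linear_combination hd₂ + coord n 2 * d * h

theorem span_der (n : ℕ) :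
    Submodule.span (SurfaceRing n) {derXY n, derToZ n, derToX n, derYZ n} = ⊤ := by
  refine eq_top_iff.2 fun D _ => ?_
  obtain ⟨r₁, r₂, r₃, r₄, rfl⟩ := exists_der_eq n D
  refine add_mem (add_mem (add_mem ?_ ?_) ?_) ?_ <;>
    exact Submodule.smul_mem _ _ (Submodule.subset_span (by simp))

/-- The map `D ↦ (D x, D z)`. -/
def derXZ (n : ℕ) : Der n →ₗ[SurfaceRing n] Fin 2 → SurfaceRing n where
  toFun D := ![D (coord n 0), D (coord n 2)]
  map_add' D D' := by ext i; fin_cases i <;> simp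
  map_smul' r D := by ext i; fin_cases i <;> simp

theorem derXZ_injective (n : ℕ) : Function.Injective (derXZ n) := by
  rw [injective_iff_map_eq_zero]
  intro D hD
  have h0 : D (coord n 0) = 0 := congrFun hD 0
  have h2 : D (coord n 2) = 0 := congrFun hD 1
  refine der_ext fun i => ?_
  have h := der_relation D
  fin_cases i
  · simpa using h0
  · have h' : coord n 1 ^ n * D (coord n 1) = 0 := by
      apply mul_left_cancel₀ (add_one_ne_zero_surfaceRing n)
      rw [← h, h0, h2]
      simp
    simpa [coord_ne_zero] using h'
  · simpa using h2

/-- The rank is squeezed between the injection D ↦ (Dx, Dz) into a free module of rank 2 and the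
injection of such a module given by `derXY` and `derYZ`. -/
theorem finrank_der (n : ℕ) : Module.finrank (SurfaceRing n) (Der n) = 2 := by
  have : Module.Finite (SurfaceRing n) (Der n) :=
    ⟨Submodule.fg_def.2 ⟨_, Set.toFinite _, span_der n⟩⟩
  apply le_antisymm
  · simpa using LinearMap.finrank_le_finrank_of_injective (derXZ_injective n)
  · let g : (Fin 2 → SurfaceRing n) →ₗ[SurfaceRing n] Der n :=
      Fintype.linearCombination (SurfaceRing n) ![derXY n, derYZ n]
    have hg : Function.Injective g := by
      rw [injective_iff_map_eq_zero]
      intro v hv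
      have h0 : g v (coord n 0) = 0 := by rw [hv]; rfl
      have h2 : g v (coord n 2) = 0 := by rw [hv]; rfl
      simp [g, Fintype.linearCombination_apply, coord_ne_zero] at h0 h2
      have hn := add_one_ne_zero_surfaceRing n
      ext i
      fin_cases i
      · exact h0.resolve_right hn
      · exact h2.resolve_right hn
    simpa using LinearMap.finrank_le_finrank_of_injective hg

end ASing
end

noncomputable section

/-! ### Pullbacks of modules to domains, modulo torsion -/

/-- If, up to torsion, `r` elements of `M` generate the pullback of `M` to the domain `B`, and if
these elements are separated by `r` functionals, then the pullback of `M` modulo torsion is free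
of rank `r`. -/
theorem freeModTorsion_of_generators {R B : Type} [CommRing R] [CommRing B] [IsDomain B]
    (φ : R →+* B) {M : Type} [AddCommGroup M] [Module R M] {r : ℕ} (g : Fin r → M)
    (G : Set M) (hG : Submodule.span R G = ⊤)
    (hgen : ∀ m ∈ G, ∃ (i : Fin r) (c d : R) (b : B), φ c ≠ 0 ∧ φ d = φ c * b ∧ c • m = d • g i)
    (θ : M →ₗ[R] Fin r → R) (hdiag : ∀ i, φ (θ (g i) i) ≠ 0)
    (hoff : ∀ i j, i ≠ j → θ (g i) j = 0) : FreeModTorsion φ M r := by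
  let _ := φ.toAlgebra
  let N := (B ⊗[R] M) ⧸ Submodule.torsion B (B ⊗[R] M)
  change Nonempty (N ≃ₗ[B] (Fin r → B))
  let π : (B ⊗[R] M) →ₗ[B] N := Submodule.mkQ _
  have hφ (c : R) : algebraMap R B c = φ c := rfl
  have hspan : ⊤ ≤ Submodule.span B (Set.range fun i => π (1 ⊗ₜ g i)) := by
    have h1 : Submodule.span B ((fun m : M => π (1 ⊗ₜ[R] m)) '' G) = ⊤ := by
      rw [← Set.image_image π (fun m : M => (1 : B) ⊗ₜ[R] m), Submodule.span_image]
      have : Submodule.span B ((fun m : M => (1 : B) ⊗ₜ[R] m) '' G) = ⊤ := by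
        have := Submodule.baseChange_span (A := B) (R := R) G
        rw [hG, Submodule.baseChange_top] at this
        exact this.symm
      rw [this, Submodule.map_top, Submodule.range_mkQ]
    rw [← h1, Submodule.span_le]
    rintro _ ⟨m, hm, rfl⟩
    obtain ⟨i, c, d, b, hc, hd, h⟩ := hgen m hm
    -- The difference is killed by φ(c) ≠ 0, hence is torsion: multiplication by φ(c) turns it into
    -- c • m - d • g i.
    have : π (1 ⊗ₜ m) = b • π (1 ⊗ₜ g i) := by
      rw [← sub_eq_zero, ← map_smul, ← map_sub, Submodule.mkQ_apply, Submodule.Quotient.mk_eq_zero,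
        Submodule.mem_torsion_iff]
      refine ⟨⟨φ c, mem_nonZeroDivisors_of_ne_zero hc⟩, ?_⟩
      rw [Submonoid.mk_smul, smul_sub, smul_smul, ← hd, ← hφ, ← hφ, algebraMap_smul, algebraMap_smul,
        ← TensorProduct.tmul_smul, ← TensorProduct.tmul_smul, h, sub_self]
    change π (1 ⊗ₜ m) ∈ _
    rw [this]
    exact Submodule.smul_mem _ _ (Submodule.subset_span ⟨i, rfl⟩)
  -- The base change of θ is diagonal with nonzero entries on the chosen elements. Applied to a
  -- torsion combination of them, it forces every coefficient to vanish.
  let θB : (B ⊗[R] M) →ₗ[B] Fin r → B := LinearMap.pi fun i =>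
    LinearMap.liftBaseChange B
      ((Algebra.linearMap R B).comp ((LinearMap.proj i).comp θ))
  have hli : LinearIndependent B fun i => π (1 ⊗ₜ g i) := by
    rw [Fintype.linearIndependent_iff]
    intro c hc j
    have hc' : ∑ i, c i • (1 ⊗ₜ g i) ∈ Submodule.torsion B (B ⊗[R] M) := by
      rw [← Submodule.Quotient.mk_eq_zero]
      change π _ = 0
      rw [map_sum]
      simpa only [map_smul] using hc
    obtain ⟨a, ha⟩ := (Submodule.mem_torsion_iff _).1 hc'
    have ha0 : (a : B) ≠ 0 := nonZeroDivisors.ne_zero a.2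
    have h := congrFun (congrArg θB ha) j
    change θB ((a : B) • _) j = _ at h
    rw [map_smul, map_sum, map_zero, Pi.smul_apply, Finset.sum_apply,
      Finset.sum_eq_single j] at h
    · simp only [map_smul, Pi.smul_apply, smul_eq_mul, Pi.zero_apply, mul_eq_zero, ha0,
        false_or] at h
      refine h.resolve_right ?_
      simpa [θB, hφ] using hdiag j
    · intro i _ hij
      simp [θB, hoff i j hij]
    · simp
  exact ⟨(Module.Basis.mk hli hspan).equivFun⟩

/-- A free pullback of rank `r` yields a semilinear map to a free module with spanning image, through
which all torsion-free quotients of the pullback factor. -/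
theorem FreeModTorsion.exists_map {R B : Type} [CommRing R] [CommRing B] [IsDomain B]
    {φ : R →+* B} {M : Type} [AddCommGroup M] [Module R M] {r : ℕ} (h : FreeModTorsion φ M r) :
    ∃ μ : M →ₛₗ[φ] (Fin r → B), Submodule.span B (Set.range μ) = ⊤ ∧
      ∀ (s : ℕ) (ν : M →ₛₗ[φ] (Fin s → B)), ∃ ψ : (Fin r → B) →ₗ[B] (Fin s → B),
        ∀ m, ψ (μ m) = ν m := by
  let _ := φ.toAlgebra
  obtain ⟨e⟩ := h
  let π : (B ⊗[R] M) →ₗ[B] _ := e.toLinearMap ∘ₗ Submodule.mkQ (Submodule.torsion B (B ⊗[R] M))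
  have hφ (c : R) : algebraMap R B c = φ c := rfl
  have hπ : Function.Surjective π := e.surjective.comp (Submodule.mkQ_surjective _)
  refine ⟨{ toFun := fun m => π (1 ⊗ₜ m), map_add' := ?_, map_smul' := ?_ }, ?_, ?_⟩
  · intro m m'
    rw [TensorProduct.tmul_add, map_add]
  · intro c m
    rw [TensorProduct.tmul_smul, ← hφ, ← map_smul, algebraMap_smul]
  · change Submodule.span B (Set.range fun m : M => π (1 ⊗ₜ[R] m)) = ⊤
    rw [← Function.comp_def π, Set.range_comp, Submodule.span_image]
    have : Submodule.span B (Set.range fun m : M => (1 : B) ⊗ₜ[R] m) = ⊤ := by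
      have := Submodule.baseChange_span (A := B) (R := R) (Set.univ : Set M)
      rw [Submodule.span_univ, Submodule.baseChange_top, Set.image_univ] at this
      exact this.symm
    rw [this, Submodule.map_top, LinearMap.range_eq_top.2 hπ]
  · intro s ν
    let ν' : M →ₗ[R] (Fin s → B) :=
      { toFun := ν, map_add' := ν.map_add, map_smul' := fun c m => by
          rw [ν.map_smulₛₗ, ← hφ, algebraMap_smul, RingHom.id_apply] }
    let νB : (B ⊗[R] M) →ₗ[B] (Fin s → B) := LinearMap.liftBaseChange B ν'
    -- The target is free over a domain, so the extension of ν kills torsion and descends to the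
    -- free quotient.
    have hν : Submodule.torsion B (B ⊗[R] M) ≤ LinearMap.ker νB := by
      intro t ht
      obtain ⟨a, ha⟩ := (Submodule.mem_torsion_iff _).1 ht
      have ha0 : (a : B) ≠ 0 := nonZeroDivisors.ne_zero a.2
      have h := congrArg νB ha
      change νB ((a : B) • t) = _ at h
      rw [map_smul, map_zero] at h
      exact (smul_eq_zero.1 h).resolve_left ha0
    refine ⟨(Submodule.liftQ _ νB hν) ∘ₗ e.symm.toLinearMap, fun m => ?_⟩
    simp [π, νB, ν']

end

noncomputable section

namespace ASing

open MvPolynomial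

/-! ### Local freeness of the pullback of the derivations -/

/-- The first-order Taylor expansion of functions on the surface at the singular point. -/
def taylor {n : ℕ} (hn : 1 ≤ n) : SurfaceRing n →ₐ[ℂ] TrivSqZeroExt ℂ (Fin 3 → ℂ) :=
  surfaceLift n (TrivSqZeroExt.inr (Pi.single 0 1)) (TrivSqZeroExt.inr (Pi.single 1 1))
    (TrivSqZeroExt.inr (Pi.single 2 1)) (by
      -- Because n + 1 ≥ 2, both sides of the relation are products of square-zero elements and
      -- vanish.
      obtain ⟨k, rfl⟩ := Nat.exists_eq_add_of_le' hn
      rw [pow_succ, pow_succ, mul_assoc, TrivSqZeroExt.inr_mul_inr, TrivSqZeroExt.inr_mul_inr,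
        mul_zero])

theorem taylor_coord {n : ℕ} (hn : 1 ≤ n) (i : Fin 3) :
    taylor hn (coord n i) = TrivSqZeroExt.inr (Pi.single i 1) := by
  rw [taylor, surfaceLift_coord]
  fin_cases i <;> rfl

/-- Without a constant term in D(y), the linear part of (rD)(y) is the value of r at the singular
point times that of D(y). This makes D ↦ (linear part of D(y)) a map on the fibre of Der there. -/
theorem fst_taylor_der {n : ℕ} (hn : 1 ≤ n) (D : Der n) : (taylor hn (D (coord n 1))).fst = 0 := by
  obtain ⟨b₀, b₁, b₂, h⟩ := der_y_mem n D
  rw [h]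
  simp [taylor_coord]

@[simp]
theorem derXZ_apply_zero {n : ℕ} (D : Der n) : derXZ n D 0 = D (coord n 0) := rfl

@[simp]
theorem derXZ_apply_one {n : ℕ} (D : Der n) : derXZ n D 1 = D (coord n 2) := rfl

section Free

variable {n : ℕ} {B : Type} [CommRing B] [IsDomain B] (φ : SurfaceRing n →+* B)

theorem map_add_one_ne_zero : φ (n + 1) ≠ 0 := by
  have h := congrArg φ (add_one_mul_algebraMap_inv n)
  rw [map_mul, map_one] at h
  exact left_ne_zero_of_mul_eq_one h

/-- With t = y/x, modulo torsion `derToZ` is tyⁿ⁻¹ times `derXY` and `derYZ` is t times `derToX`.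
The functionals D ↦ Dx and D ↦ Dz separate the two remaining generators, as `derXY` kills z and
`derToX` kills x. -/
theorem freeModTorsion_der_first (hn : 1 ≤ n) (h : ∀ i, φ (coord n i) ≠ 0) {t : B}
    (ht : φ (coord n 1) = φ (coord n 0) * t) : FreeModTorsion φ (Der n) 2 := by
  refine freeModTorsion_of_generators φ ![derXY n, derToX n] _ (span_der n) ?_ (derXZ n) ?_ ?_
  · rintro m (rfl | rfl | rfl | rfl)
    · exact ⟨0, 1, 1, 1, by simp, by simp, rfl⟩
    · refine ⟨0, coord n 0, coord n 1 ^ n, t * φ (coord n 1) ^ (n - 1), h 0, ?_, 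
      x_smul_derToZ n⟩
      obtain ⟨k, rfl⟩ := Nat.exists_eq_add_of_le' hn
      simp only [map_pow, Nat.add_sub_cancel]
      linear_combination φ (coord _ 1) ^ k * ht
    · exact ⟨1, 1, 1, 1, by simp, by simp, rfl⟩
    · exact ⟨1, coord n 0, coord n 1, t, h 0, ht, (y_smul_derToX n).symm⟩
  · have hφ := map_add_one_ne_zero φ
    intro i
    fin_cases i
    · change φ (derXZ n (derXY n) 0) ≠ 0
      rw [derXZ_apply_zero, derXY_coord]
      simpa only [Matrix.cons_val, map_mul, map_pow] using mul_ne_zero hφ (h 0)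
    · change φ (derXZ n (derToX n) 1) ≠ 0
      rw [derXZ_apply_one, derToX_coord]
      simpa only [Matrix.cons_val, map_mul, map_pow] using mul_ne_zero hφ (pow_ne_zero n (h 1))
  · intro i j hij
    fin_cases i <;> fin_cases j
    · exact absurd rfl hij
    · change derXZ n (derXY n) 1 = 0
      rw [derXZ_apply_one, derXY_coord]
      rfl
    · change derXZ n (derToX n) 0 = 0
      rw [derXZ_apply_zero, derToX_coord]
      rfl
    · exact absurd rfl hij

/-- This is the mirror image under x ↔ z of the first chart: with q = y/z, the generators are
`derToZ` and `derYZ`. -/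
theorem freeModTorsion_der_last (hn : 1 ≤ n) (h : ∀ i, φ (coord n i) ≠ 0) {q : B}
    (hq : φ (coord n 1) = φ (coord n 2) * q) : FreeModTorsion φ (Der n) 2 := by
  refine freeModTorsion_of_generators φ ![derToZ n, derYZ n] _ (span_der n) ?_ (derXZ n) ?_ ?_
  · rintro m (rfl | rfl | rfl | rfl)
    · exact ⟨0, coord n 2, coord n 1, q, h 2, hq, (y_smul_derToZ n).symm⟩
    · exact ⟨0, 1, 1, 1, by simp, by simp, rfl⟩
    · refine ⟨1, coord n 2, coord n 1 ^ n, q * φ (coord n 1) ^ (n - 1), h 2, ?_, 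
      z_smul_derToX n⟩
      obtain ⟨k, rfl⟩ := Nat.exists_eq_add_of_le' hn
      simp only [map_pow, Nat.add_sub_cancel]
      linear_combination φ (coord _ 1) ^ k * hq
    · exact ⟨1, 1, 1, 1, by simp, by simp, rfl⟩
  · have hφ := map_add_one_ne_zero φ
    intro i
    fin_cases i
    · change φ (derXZ n (derToZ n) 0) ≠ 0
      rw [derXZ_apply_zero, derToZ_coord]
      simpa only [Matrix.cons_val, map_mul, map_pow] using mul_ne_zero hφ (pow_ne_zero n (h 1))
    · change φ (derXZ n (derYZ n) 1) ≠ 0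
      rw [derXZ_apply_one, derYZ_coord]
      simpa only [Matrix.cons_val, map_mul, map_pow] using mul_ne_zero hφ (h 2)
  · intro i j hij
    fin_cases i <;> fin_cases j
    · exact absurd rfl hij
    · change derXZ n (derToZ n) 1 = 0
      rw [derXZ_apply_one, derToZ_coord]
      rfl
    · change derXZ n (derYZ n) 0 = 0
      rw [derXZ_apply_zero, derYZ_coord]
      rfl
    · exact absurd rfl hij

/-- Here a = x/y and b = z/y, so `derToZ` is b times `derXY` and `derToX` is a times `derYZ`. -/
theorem freeModTorsion_der_middle (h : ∀ i, φ (coord n i) ≠ 0) {a b : B}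
    (ha : φ (coord n 0) = φ (coord n 1) * a) (hb : φ (coord n 2) = φ (coord n 1) * b) :
    FreeModTorsion φ (Der n) 2 := by
  refine freeModTorsion_of_generators φ ![derXY n, derYZ n] _ (span_der n) ?_ (derXZ n) ?_ ?_
  · rintro m (rfl | rfl | rfl | rfl)
    · exact ⟨0, 1, 1, 1, by simp, by simp, rfl⟩
    · exact ⟨0, coord n 1, coord n 2, b, h 1, hb, y_smul_derToZ n⟩
    · exact ⟨1, coord n 1, coord n 0, a, h 1, ha, y_smul_derToX n⟩
    · exact ⟨1, 1, 1, 1, by simp, by simp, rfl⟩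
  · have hφ := map_add_one_ne_zero φ
    intro i
    fin_cases i
    · change φ (derXZ n (derXY n) 0) ≠ 0
      rw [derXZ_apply_zero, derXY_coord]
      simpa only [Matrix.cons_val, map_mul, map_pow] using mul_ne_zero hφ (h 0)
    · change φ (derXZ n (derYZ n) 1) ≠ 0
      rw [derXZ_apply_one, derYZ_coord]
      simpa only [Matrix.cons_val, map_mul, map_pow] using mul_ne_zero hφ (h 2)
  · intro i j hij
    fin_cases i <;> fin_cases j
    · exact absurd rfl hij
    · change derXZ n (derXY n) 1 = 0
      rw [derXZ_apply_one, derXY_coord]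
      rfl
    · change derXZ n (derYZ n) 0 = 0
      rw [derXZ_apply_zero, derYZ_coord]
      rfl
    · exact absurd rfl hij

/-- If all coordinates die, φ is evaluation at the singular point followed by ℂ → B. The linear part
of D(y) then maps the pullback onto B³, which a free module of rank 2 does not allow. -/
theorem exists_coord_ne_zero_of_freeModTorsion (hn : 1 ≤ n) (h : FreeModTorsion φ (Der n) 2) :
    ∃ i, φ (coord n i) ≠ 0 := by
  by_contra! h0
  let _ : Algebra ℂ B := (φ.comp (algebraMap ℂ (SurfaceRing n))).toAlgebra
  let φ' : SurfaceRing n →ₐ[ℂ] B := { φ with commutes' := fun _ => rfl }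
  have hφ' : φ' = (Algebra.ofId ℂ B).comp
      ((TrivSqZeroExt.fstHom ℂ ℂ (Fin 3 → ℂ)).comp (taylor hn)) := by
    refine surfaceRing_algHom_ext fun i => (h0 i).trans ?_
    simp [taylor_coord]
  have hφ (r : SurfaceRing n) : φ r = algebraMap ℂ B (taylor hn r).fst :=
    DFunLike.congr_fun hφ' r
  let ν : Der n →ₛₗ[φ] (Fin 3 → B) :=
    { toFun := fun D i => algebraMap ℂ B ((taylor hn (D (coord n 1))).snd i)
      map_add' := fun D D' => by
        ext i
        simp
      map_smul' := fun r D => by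
        ext i
        simp [hφ, fst_taylor_der] }
  obtain ⟨μ, -, hμ⟩ := h.exists_map
  obtain ⟨ψ, hψ⟩ := hμ 3 ν
  have hs : Function.Surjective ψ := by
    rw [← LinearMap.range_eq_top, eq_top_iff, ← (Pi.basisFun B (Fin 3)).span_eq, Submodule.span_le]
    rintro _ ⟨i, rfl⟩
    -- These three derivations send y to x, y, z, whose linear parts are the standard basis.
    refine ⟨μ (![derToX n, derXY n, derToZ n] i), ?_⟩
    rw [hψ]
    ext j
    fin_cases i <;> fin_cases j <;> simp [ν, taylor_coord]
  have := card_le_of_surjective B ψ hs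
  simp at this

/-! ### Minors of the four generators -/

/-- The determinant of two vectors in the plane. -/
def planeDet (u v : Fin 2 → B) : B := u 0 * v 1 - u 1 * v 0

/-- If the pullback of the derivations is free of rank two modulo torsion, then locally
the source maps to one of the charts of the blow-up. -/
theorem exists_minors_of_freeModTorsion (hn : 1 ≤ n) (h : FreeModTorsion φ (Der n) 2) :
    ∃ m c : Fin 4 → B, ∑ k, c k * m k = 1 ∧ ∀ k,
      (∃ b, φ (coord n 1) * m k = φ (coord n 0) * b ∧ φ (coord n 2) * m k = φ (coord n 1) ^ n * b) ∨
      (∃ b, φ (coord n 1) * m k = φ (coord n 2) * b ∧ φ (coord n 0) * m k = φ (coord n 1) ^ n * b) ∨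
      (∃ a b, φ (coord n 2) * m k = φ (coord n 1) * b ∧ φ (coord n 0) * m k = φ (coord n 1) * a ∧
        φ (coord n 1) ^ n * m k = φ (coord n 0) * b ∧
        φ (coord n 1) ^ n * m k = φ (coord n 2) * a) := by
  have hxyz : φ (coord n 0) ≠ 0 ∨ φ (coord n 1) ≠ 0 ∨ φ (coord n 2) ≠ 0 := by
    obtain ⟨i, hi⟩ := exists_coord_ne_zero_of_freeModTorsion φ hn h
    fin_cases i
    exacts [Or.inl hi, Or.inr (Or.inl hi), Or.inr (Or.inr hi)]
  obtain ⟨μ, hspan, -⟩ := h.exists_map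
  have hgen (v : Fin 2 → B) : ∃ c₁ c₂ c₃ c₄ : B,
      v = c₁ • μ (derXY n) + c₂ • μ (derToZ n) + c₃ • μ (derToX n) + c₄ • μ (derYZ n) := by
    have hv : v ∈ Submodule.span B (Set.range μ) := hspan ▸ Submodule.mem_top
    induction hv using Submodule.span_induction with
    | mem v hv =>
      obtain ⟨D, rfl⟩ := hv
      obtain ⟨r₁, r₂, r₃, r₄, rfl⟩ := exists_der_eq n D
      exact ⟨φ r₁, φ r₂, φ r₃, φ r₄, by simp [LinearMap.map_smulₛₗ]⟩
    | zero => exact ⟨0, 0, 0, 0, by simp⟩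
    | add v w _ _ hv hw =>
      obtain ⟨a₁, a₂, a₃, a₄, rfl⟩ := hv
      obtain ⟨b₁, b₂, b₃, b₄, rfl⟩ := hw
      exact ⟨a₁ + b₁, a₂ + b₂, a₃ + b₃, a₄ + b₄, by module⟩
    | smul b v _ hv =>
      obtain ⟨a₁, a₂, a₃, a₄, rfl⟩ := hv
      exact ⟨b * a₁, b * a₂, b * a₃, b * a₄, by module⟩
  have r₁ (j) : φ (coord n 1) * μ (derToZ n) j = φ (coord n 2) * μ (derXY n) j := by
    simpa [LinearMap.map_smulₛₗ] using congrFun (congrArg μ (y_smul_derToZ n)) j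
  have r₂ (j) : φ (coord n 0) * μ (derToZ n) j = φ (coord n 1) ^ n * μ (derXY n) j := by
    simpa [LinearMap.map_smulₛₗ] using congrFun (congrArg μ (x_smul_derToZ n)) j
  have r₃ (j) : φ (coord n 1) * μ (derToX n) j = φ (coord n 0) * μ (derYZ n) j := by
    simpa [LinearMap.map_smulₛₗ] using congrFun (congrArg μ (y_smul_derToX n)) j
  have r₄ (j) : φ (coord n 2) * μ (derToX n) j = φ (coord n 1) ^ n * μ (derYZ n) j := by
    simpa [LinearMap.map_smulₛₗ] using congrFun (congrArg μ (z_smul_derToX n)) j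
  generalize μ (derXY n) = u, μ (derToZ n) = v, μ (derToX n) = w, μ (derYZ n) = e at hgen r₁ r₂ r₃ r₄
  generalize φ (coord n 0) = x, φ (coord n 1) = y, φ (coord n 2) = z at hxyz r₁ r₂ r₃ r₄ ⊢
  -- Proportional vectors: the relations show that x, y and z each kill u ∧ v, and one of them is
  -- nonzero in the domain B. The same applies to w ∧ e.
  have huv : x * planeDet u v = 0 ∧ y * planeDet u v = 0 ∧ z * planeDet u v = 0 := by
    simp only [planeDet]
    refine ⟨?_, ?_, ?_⟩
    · linear_combination u 0 * r₂ 1 - u 1 * r₂ 0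
    · linear_combination u 0 * r₁ 1 - u 1 * r₁ 0
    · linear_combination -v 1 * r₁ 0 + v 0 * r₁ 1
  have hwe : x * planeDet w e = 0 ∧ y * planeDet w e = 0 ∧ z * planeDet w e = 0 := by
    simp only [planeDet]
    refine ⟨?_, ?_, ?_⟩
    · linear_combination w 1 * r₃ 0 - w 0 * r₃ 1
    · linear_combination e 1 * r₃ 0 - e 0 * r₃ 1
    · linear_combination e 1 * r₄ 0 - e 0 * r₄ 1
  have hcancel {d : B} (hd : x * d = 0 ∧ y * d = 0 ∧ z * d = 0) : d = 0 := by
    rcases hxyz with h | h | h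
    exacts [(mul_eq_zero.1 hd.1).resolve_left h, (mul_eq_zero.1 hd.2.1).resolve_left h,
      (mul_eq_zero.1 hd.2.2).resolve_left h]
  replace huv := hcancel huv
  replace hwe := hcancel hwe
  obtain ⟨a₁, a₂, a₃, a₄, ha⟩ := hgen ![1, 0]
  obtain ⟨b₁, b₂, b₃, b₄, hb⟩ := hgen ![0, 1]
  have ha₀ := congrFun ha 0
  have ha₁ := congrFun ha 1
  have hb₀ := congrFun hb 0
  have hb₁ := congrFun hb 1
  simp at ha₀ ha₁ hb₀ hb₁
  simp only [planeDet] at huv hwe ⊢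
  -- The coefficients are the complementary minors of the expressions of the standard basis: this is
  -- Cauchy–Binet for the identity matrix, with the zero minors u ∧ v and w ∧ e left out. The minors
  -- u ∧ w and v ∧ w lead to the first chart, v ∧ e to the last and u ∧ e to the middle one.
  refine ⟨![planeDet u w, planeDet v w, planeDet v e, planeDet u e],
    ![a₁ * b₃ - a₃ * b₁, a₂ * b₃ - a₃ * b₂, a₂ * b₄ - a₄ * b₂, a₁ * b₄ - a₄ * b₁], ?_, fun k => ?_⟩
  · simp [Fin.sum_univ_four, planeDet]
    linear_combination
      -(b₁ * u 1 + b₂ * v 1 + b₃ * w 1 + b₄ * e 1) * ha₀ - hb₁ +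
        (b₁ * u 0 + b₂ * v 0 + b₃ * w 0 + b₄ * e 0) * ha₁ -
        (a₁ * b₂ - a₂ * b₁) * huv - (a₃ * b₄ - a₄ * b₃) * hwe
  · fin_cases k
    · refine Or.inl ⟨planeDet u e, ?_, ?_⟩ <;> simp [planeDet]
      · linear_combination u 0 * r₃ 1 - u 1 * r₃ 0
      · linear_combination u 0 * r₄ 1 - u 1 * r₄ 0
    · refine Or.inl ⟨planeDet v e, ?_, ?_⟩ <;> simp [planeDet]
      · linear_combination v 0 * r₃ 1 - v 1 * r₃ 0
      · linear_combination v 0 * r₄ 1 - v 1 * r₄ 0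
    · refine Or.inr (Or.inl ⟨planeDet u e, ?_, ?_⟩) <;> simp [planeDet]
      · linear_combination e 1 * r₁ 0 - e 0 * r₁ 1
      · linear_combination e 1 * r₂ 0 - e 0 * r₂ 1
    · refine Or.inr (Or.inr ⟨planeDet u w, planeDet v e, ?_, ?_, ?_, ?_⟩) <;> simp [planeDet]
      · linear_combination -e 1 * r₁ 0 + e 0 * r₁ 1
      · linear_combination -u 0 * r₃ 1 + u 1 * r₃ 0
      · linear_combination -e 1 * r₂ 0 + e 0 * r₂ 1
      · linear_combination -u 0 * r₄ 1 + u 1 * r₄ 0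

end Free

end ASing
end

noncomputable section

namespace ASing

open MvPolynomial

/-! ### Algebra of the charts -/

/-- Two pairs of homomorphisms `c₁`, `o₁` and `c₂`, `o₂` with the following property: homomorphisms
of the targets of `c₁` and `c₂` to a domain that agree on the surface ring, and do not kill all the
coordinates, come from the common target of `o₁` and `o₂`. -/
def SeparatedBy {n : ℕ} {A₁ A₂ V : Type} [CommRing A₁] [CommRing A₂] [CommRing V]
    [Algebra ℂ A₁] [Algebra ℂ A₂] [Algebra ℂ V]
    (c₁ : SurfaceRing n →ₐ[ℂ] A₁) (c₂ : SurfaceRing n →ₐ[ℂ] A₂)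
    (o₁ : A₁ →ₐ[ℂ] V) (o₂ : A₂ →ₐ[ℂ] V) : Prop :=
  ∀ (B : Type) [CommRing B] [IsDomain B] [Algebra ℂ B] (ψ₁ : A₁ →ₐ[ℂ] B) (ψ₂ : A₂ →ₐ[ℂ] B),
    ψ₁.comp c₁ = ψ₂.comp c₂ → (∃ i, ψ₁ (c₁ (coord n i)) ≠ 0) →
    ∃ θ : V →ₐ[ℂ] B, θ.comp o₁ = ψ₁ ∧ θ.comp o₂ = ψ₂

theorem SeparatedBy.symm {n : ℕ} {A₁ A₂ V : Type} [CommRing A₁] [CommRing A₂] [CommRing V]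
    [Algebra ℂ A₁] [Algebra ℂ A₂] [Algebra ℂ V]
    {c₁ : SurfaceRing n →ₐ[ℂ] A₁} {c₂ : SurfaceRing n →ₐ[ℂ] A₂}
    {o₁ : A₁ →ₐ[ℂ] V} {o₂ : A₂ →ₐ[ℂ] V} (h : SeparatedBy c₁ c₂ o₁ o₂) :
    SeparatedBy c₂ c₁ o₂ o₁ := by
  intro B _ _ _ ψ₁ ψ₂ heq hne
  obtain ⟨θ, h₁, h₂⟩ := h B ψ₂ ψ₁ heq.symm (by
    obtain ⟨i, hi⟩ := hne
    exact ⟨i, by rwa [← AlgHom.comp_apply, ← heq]⟩)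
  exact ⟨θ, h₂, h₁⟩

/-- The inclusion of the coordinate ring of the plane into that of a principal open subset. -/
abbrev planeAwayMap (g : PlaneRing) : PlaneRing →ₐ[ℂ] PlaneAway g :=
  IsScalarTower.toAlgHom ℂ PlaneRing (PlaneAway g)

theorem exists_planeAway_lift {B : Type} [CommRing B] [Algebra ℂ B] (g : PlaneRing)
    (ψ : PlaneRing →ₐ[ℂ] B) {u : B} (h : ψ g * u = 1) :
    ∃ θ : PlaneAway g →ₐ[ℂ] B, θ.comp (planeAwayMap g) = ψ ∧ (∀ p, θ (resFn g p) = ψ p) ∧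
      θ (invFn g) = u := by
  have hu : ∀ y : Submonoid.powers g, IsUnit (ψ y) := by
    rintro ⟨_, k, rfl⟩
    simpa using (IsUnit.of_mul_eq_one _ h).pow k
  have hθ (p) : (IsLocalization.liftAlgHom hu : PlaneAway g →ₐ[ℂ] B) (resFn g p) = ψ p :=
    IsLocalization.lift_eq _ p
  refine ⟨IsLocalization.liftAlgHom hu, AlgHom.ext hθ, hθ, ?_⟩
  have h1 := congrArg (IsLocalization.liftAlgHom hu : PlaneAway g →ₐ[ℂ] B)
    (IsLocalization.Away.mul_invSelf (S := PlaneAway g) g)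
  rw [map_mul, hθ, map_one] at h1
  exact (IsUnit.of_mul_eq_one _ h).mul_left_cancel (h1.trans h.symm)

section Values

variable {n : ℕ} {B : Type} [CommRing B] [Algebra ℂ B]

theorem chartFirst_coord (i : Fin 3) :
    chartFirst n (coord n i) = ![X 0, X 0 * X 1, X 0 ^ n * X 1 ^ (n + 1)] i :=
  surfaceLift_coord ..

theorem chartLast_coord (i : Fin 3) :
    chartLast n (coord n i) = ![X 0 ^ n * X 1 ^ (n + 1), X 0 * X 1, X 0] i :=
  surfaceLift_coord ..

theorem chartMiddle_coord (hn : 2 ≤ n) (i : Fin 3) :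
    chartMiddle n hn (coord n i) = ![coord (n - 2) 0 * coord (n - 2) 1, coord (n - 2) 1,
      coord (n - 2) 2 * coord (n - 2) 1] i :=
  surfaceLift_coord ..

theorem comp_chartFirst_eq_iff (ψ : PlaneRing →ₐ[ℂ] B) (φ : SurfaceRing n →ₐ[ℂ] B) :
    ψ.comp (chartFirst n) = φ ↔ ψ (X 0) = φ (coord n 0) ∧ ψ (X 0) * ψ (X 1) = φ (coord n 1) ∧
      ψ (X 0) ^ n * ψ (X 1) ^ (n + 1) = φ (coord n 2) := by
  constructor
  · rintro rfl
    simp [chartFirst_coord]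
  · rintro ⟨h0, h1, h2⟩
    refine surfaceRing_algHom_ext fun i => ?_
    rw [AlgHom.comp_apply, chartFirst_coord]
    fin_cases i
    · simpa using h0
    · simpa using h1
    · simpa using h2

theorem comp_chartLast_eq_iff (ψ : PlaneRing →ₐ[ℂ] B) (φ : SurfaceRing n →ₐ[ℂ] B) :
    ψ.comp (chartLast n) = φ ↔ ψ (X 0) ^ n * ψ (X 1) ^ (n + 1) = φ (coord n 0) ∧
      ψ (X 0) * ψ (X 1) = φ (coord n 1) ∧ ψ (X 0) = φ (coord n 2) := by
  constructor
  · rintro rfl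
    simp [chartLast_coord]
  · rintro ⟨h0, h1, h2⟩
    refine surfaceRing_algHom_ext fun i => ?_
    rw [AlgHom.comp_apply, chartLast_coord]
    fin_cases i
    · simpa using h0
    · simpa using h1
    · simpa using h2

theorem comp_chartMiddle_eq_iff (hn : 2 ≤ n) (ψ : SurfaceRing (n - 2) →ₐ[ℂ] B)
    (φ : SurfaceRing n →ₐ[ℂ] B) :
    ψ.comp (chartMiddle n hn) = φ ↔
      ψ (coord (n - 2) 0) * ψ (coord (n - 2) 1) = φ (coord n 0) ∧
      ψ (coord (n - 2) 1) = φ (coord n 1) ∧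
      ψ (coord (n - 2) 2) * ψ (coord (n - 2) 1) = φ (coord n 2) := by
  constructor
  · rintro rfl
    simp [chartMiddle_coord]
  · rintro ⟨h0, h1, h2⟩
    refine surfaceRing_algHom_ext fun i => ?_
    rw [AlgHom.comp_apply, chartMiddle_coord]
    fin_cases i
    · simpa using h0
    · simpa using h1
    · simpa using h2

theorem exists_comp_chartFirst_eq (φ : SurfaceRing n →ₐ[ℂ] B) (t : B)
    (h₁ : φ (coord n 1) = φ (coord n 0) * t) (h₂ : φ (coord n 2) = φ (coord n 1) ^ n * t) :
    ∃ ψ : PlaneRing →ₐ[ℂ] B, ψ.comp (chartFirst n) = φ := by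
  refine ⟨aeval ![φ (coord n 0), t], (comp_chartFirst_eq_iff _ _).2 ?_⟩
  simp only [aeval_X, Matrix.cons_val]
  refine ⟨trivial, h₁.symm, ?_⟩
  rw [h₂, h₁]
  ring

theorem exists_comp_chartLast_eq (φ : SurfaceRing n →ₐ[ℂ] B) (q : B)
    (h₁ : φ (coord n 1) = φ (coord n 2) * q) (h₀ : φ (coord n 0) = φ (coord n 1) ^ n * q) :
    ∃ ψ : PlaneRing →ₐ[ℂ] B, ψ.comp (chartLast n) = φ := by
  refine ⟨aeval ![φ (coord n 2), q], (comp_chartLast_eq_iff _ _).2 ?_⟩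
  simp only [aeval_X, Matrix.cons_val]
  refine ⟨?_, h₁.symm, trivial⟩
  rw [h₀, h₁]
  ring

/-- If y vanished, so would x = ya and z = yb; hence y can be cancelled from yⁿ = xb = yab, which
gives the equation ab = yⁿ⁻¹ of A_{n-2}. -/
theorem exists_comp_chartMiddle_eq [IsDomain B] (hn : 2 ≤ n) (φ : SurfaceRing n →ₐ[ℂ] B)
    (hne : ∃ i, φ (coord n i) ≠ 0) (a b : B)
    (h₂ : φ (coord n 2) = φ (coord n 1) * b) (h₀ : φ (coord n 0) = φ (coord n 1) * a)
    (hb : φ (coord n 1) ^ n = φ (coord n 0) * b) :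
    ∃ ψ : SurfaceRing (n - 2) →ₐ[ℂ] B, ψ.comp (chartMiddle n hn) = φ := by
  have hy : φ (coord n 1) ≠ 0 := by
    intro hy
    rw [hy, zero_mul] at h₂ h₀
    obtain ⟨i, hi⟩ := hne
    fin_cases i
    exacts [hi h₀, hi hy, hi h₂]
  have hab : a * b = φ (coord n 1) ^ (n - 2 + 1) := by
    apply mul_left_cancel₀ hy
    rw [← pow_succ', show n - 2 + 1 + 1 = n by omega, hb, h₀]
    ring
  refine ⟨surfaceLift (n - 2) a (φ (coord n 1)) b hab, (comp_chartMiddle_eq_iff hn _ _).2 ?_⟩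
  simp only [surfaceLift_coord, Matrix.cons_val]
  exact ⟨by rw [h₀]; ring, trivial, by rw [h₂]; ring⟩

/-- On this chart s divides x, y and, because n ≥ 1, also z. -/
theorem comp_chartFirst_ne_zero (hn : 1 ≤ n) {ψ : PlaneRing →ₐ[ℂ] B}
    (hne : ∃ i, ψ (chartFirst n (coord n i)) ≠ 0) : ψ (X 0) ≠ 0 := by
  intro h
  obtain ⟨i, hi⟩ := hne
  rw [chartFirst_coord] at hi
  fin_cases i <;> simp [h, Nat.one_le_iff_ne_zero.1 hn] at hi

theorem comp_chartLast_ne_zero (hn : 1 ≤ n) {ψ : PlaneRing →ₐ[ℂ] B}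
    (hne : ∃ i, ψ (chartLast n (coord n i)) ≠ 0) : ψ (X 0) ≠ 0 := by
  intro h
  obtain ⟨i, hi⟩ := hne
  rw [chartLast_coord] at hi
  fin_cases i <;> simp [h, Nat.one_le_iff_ne_zero.1 hn] at hi

end Values

/-! ### Separation of pairs of charts -/

theorem planeRing_algHom_ext {B : Type} [CommRing B] [Algebra ℂ B] {f g : PlaneRing →ₐ[ℂ] B}
    (h₀ : f (X 0) = g (X 0)) (h₁ : f (X 1) = g (X 1)) : f = g := by
  refine MvPolynomial.algHom_ext fun i => ?_
  fin_cases i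
  exacts [h₀, h₁]

/-- Away from the singular point s = x is nonzero, so t is determined by st = y. With identity
overlaps, separation says that a lift to this chart is unique. -/
theorem separatedBy_first_first {n : ℕ} (hn : 1 ≤ n) :
    SeparatedBy (chartFirst n) (chartFirst n) (AlgHom.id ℂ _) (AlgHom.id ℂ _) := by
  intro B _ _ _ ψ₁ ψ₂ heq hne
  refine ⟨ψ₁, AlgHom.comp_id _, ?_⟩
  rw [AlgHom.comp_id]
  obtain ⟨h0, h1, -⟩ := (comp_chartFirst_eq_iff _ _).1 heq
  simp [chartFirst_coord] at h0 h1
  refine planeRing_algHom_ext h0 (mul_left_cancel₀ (comp_chartFirst_ne_zero hn hne) ?_)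
  rw [h1, h0]

theorem separatedBy_last_last {n : ℕ} (hn : 1 ≤ n) :
    SeparatedBy (chartLast n) (chartLast n) (AlgHom.id ℂ _) (AlgHom.id ℂ _) := by
  intro B _ _ _ ψ₁ ψ₂ heq hne
  refine ⟨ψ₁, AlgHom.comp_id _, ?_⟩
  rw [AlgHom.comp_id]
  obtain ⟨-, h1, h0⟩ := (comp_chartLast_eq_iff _ _).1 heq
  simp [chartLast_coord] at h0 h1
  refine planeRing_algHom_ext h0 (mul_left_cancel₀ (comp_chartLast_ne_zero hn hne) ?_)
  rw [h1, h0]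

theorem separatedBy_middle_middle {n : ℕ} (hn : 2 ≤ n) :
    SeparatedBy (chartMiddle n hn) (chartMiddle n hn) (AlgHom.id ℂ _) (AlgHom.id ℂ _) := by
  intro B _ _ _ ψ₁ ψ₂ heq hne
  refine ⟨ψ₁, AlgHom.comp_id _, ?_⟩
  rw [AlgHom.comp_id]
  obtain ⟨h0, h1, h2⟩ := (comp_chartMiddle_eq_iff _ _ _).1 heq
  simp [chartMiddle_coord] at h0 h1 h2
  have hy : ψ₁ (coord (n - 2) 1) ≠ 0 := by
    intro h
    obtain ⟨i, hi⟩ := hne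
    rw [chartMiddle_coord] at hi
    fin_cases i <;> simp [h] at hi
  refine surfaceRing_algHom_ext fun i => ?_
  fin_cases i
  · exact mul_right_cancel₀ hy (h0.trans (by rw [h1]; rfl))
  · exact h1
  · exact mul_right_cancel₀ hy (h2.trans (by rw [h1]; rfl))

theorem separatedBy_first_middle {n : ℕ} (hn : 2 ≤ n) :
    SeparatedBy (chartFirst n) (chartMiddle n hn) (planeAwayMap (X 1))
      (overlapFirstMiddle n hn) := by
  intro B _ _ _ ψ₁ ψ₂ heq hne
  have hs := comp_chartFirst_ne_zero (by omega) hne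
  obtain ⟨h0, h1, h2⟩ := (comp_chartFirst_eq_iff _ _).1 heq
  simp [chartMiddle_coord] at h0 h1 h2
  -- Both charts compute x and y: s = ac and st = c, so s·ta = s with s ≠ 0.
  have hu : ψ₁ (X 1) * ψ₂ (coord (n - 2) 0) = 1 := by
    apply mul_left_cancel₀ hs
    linear_combination ψ₂ (coord (n - 2) 0) * h1 - h0
  obtain ⟨θ, hθ, hres, hinv⟩ := exists_planeAway_lift _ ψ₁ hu
  refine ⟨θ, hθ, surfaceRing_algHom_ext fun i => ?_⟩
  rw [AlgHom.comp_apply, overlapFirstMiddle, surfaceLift_coord]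
  fin_cases i
  · exact hinv
  · exact (hres _).trans (by simpa using h1)
  · refine (hres _).trans ?_
    have hst : ψ₁ (X 0) * ψ₁ (X 1) ≠ 0 := mul_ne_zero hs (left_ne_zero_of_mul_eq_one hu)
    apply mul_right_cancel₀ hst
    rw [h1]
    refine Eq.trans ?_ h2
    obtain ⟨k, rfl⟩ := Nat.exists_eq_add_of_le' hn
    rw [← h1]
    simp only [map_mul, map_pow, show k + 2 - 1 = k + 1 from rfl]
    ring

theorem separatedBy_last_middle {n : ℕ} (hn : 2 ≤ n) :
    SeparatedBy (chartLast n) (chartMiddle n hn) (planeAwayMap (X 1))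
      (overlapLastMiddle n hn) := by
  intro B _ _ _ ψ₁ ψ₂ heq hne
  have hs := comp_chartLast_ne_zero (by omega) hne
  obtain ⟨h2, h1, h0⟩ := (comp_chartLast_eq_iff _ _).1 heq
  simp [chartMiddle_coord] at h0 h1 h2
  have hu : ψ₁ (X 1) * ψ₂ (coord (n - 2) 2) = 1 := by
    apply mul_left_cancel₀ hs
    linear_combination ψ₂ (coord (n - 2) 2) * h1 - h0
  obtain ⟨θ, hθ, hres, hinv⟩ := exists_planeAway_lift _ ψ₁ hu
  refine ⟨θ, hθ, surfaceRing_algHom_ext fun i => ?_⟩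
  rw [AlgHom.comp_apply, overlapLastMiddle, surfaceLift_coord]
  fin_cases i
  · refine (hres _).trans ?_
    have hst : ψ₁ (X 0) * ψ₁ (X 1) ≠ 0 := mul_ne_zero hs (left_ne_zero_of_mul_eq_one hu)
    apply mul_right_cancel₀ hst
    rw [h1]
    refine Eq.trans ?_ h2
    obtain ⟨k, rfl⟩ := Nat.exists_eq_add_of_le' hn
    rw [← h1]
    simp only [map_mul, map_pow, show k + 2 - 1 = k + 1 from rfl]
    ring
  · exact (hres _).trans (by simpa using h1)
  · exact hinv

/-- From s = pⁿqⁿ⁺¹ ≠ 0 one gets p, q ≠ 0, then t ≠ 0, and cancelling st in st = pq = sⁿtⁿ⁺¹q leaves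
sⁿ⁻¹tⁿq = 1. For n = 1 this makes only t invertible; for n ≥ 2 it makes st invertible. Hence the two
different overlaps. -/
theorem chart_first_last_relation {n : ℕ} (hn : 1 ≤ n) {B : Type} [CommRing B] [IsDomain B]
    [Algebra ℂ B] {ψ₁ ψ₂ : PlaneRing →ₐ[ℂ] B}
    (heq : ψ₁.comp (chartFirst n) = ψ₂.comp (chartLast n))
    (hne : ∃ i, ψ₁ (chartFirst n (coord n i)) ≠ 0) :
    ψ₂ (X 0) = ψ₁ (X 0) ^ n * ψ₁ (X 1) ^ (n + 1) ∧
      ψ₁ (X 0) ^ (n - 1) * ψ₁ (X 1) ^ n * ψ₂ (X 1) = 1 := by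
  have hs := comp_chartFirst_ne_zero hn hne
  obtain ⟨h0, h1, h2⟩ := (comp_chartFirst_eq_iff _ _).1 heq
  simp [chartLast_coord] at h0 h1 h2
  refine ⟨h2.symm, ?_⟩
  have hq : ψ₂ (X 1) ≠ 0 := by
    intro hq
    rw [hq, zero_pow (Nat.succ_ne_zero n), mul_zero] at h0
    exact hs h0
  have hp : ψ₂ (X 0) ≠ 0 := by
    intro hp
    rw [hp, zero_pow (by omega), zero_mul] at h0
    exact hs h0
  have ht : ψ₁ (X 1) ≠ 0 := by
    intro ht
    rw [ht, zero_pow (Nat.succ_ne_zero n), mul_zero] at h2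
    exact hp h2.symm
  apply mul_left_cancel₀ (mul_ne_zero hs ht)
  obtain ⟨k, rfl⟩ := Nat.exists_eq_add_of_le' hn
  rw [Nat.add_sub_cancel]
  linear_combination ψ₂ (X 1) * h2 - h1

theorem separatedBy_first_last {n : ℕ} (hn : 2 ≤ n) :
    SeparatedBy (chartFirst n) (chartLast n) (planeAwayMap (X 0 * X 1)) (overlapFirstLast n) := by
  intro B _ _ _ ψ₁ ψ₂ heq hne
  obtain ⟨hp, hq⟩ := chart_first_last_relation (by omega) heq hne
  obtain ⟨k, rfl⟩ := Nat.exists_eq_add_of_le' hn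
  rw [show k + 2 - 1 = k + 1 from rfl] at hq
  -- The inverse of st is sⁿ⁻²tⁿ⁻¹q, with k = n - 2.
  have hu : ψ₁ (X 0 * X 1) * (ψ₁ (X 0) ^ k * ψ₁ (X 1) ^ (k + 1) * ψ₂ (X 1)) = 1 := by
    rw [map_mul]
    linear_combination hq
  obtain ⟨θ, hθ, hres, hinv⟩ := exists_planeAway_lift _ ψ₁ hu
  refine ⟨θ, hθ, planeRing_algHom_ext ?_ ?_⟩
  · simp only [AlgHom.comp_apply, overlapFirstLast, aeval_X, Matrix.cons_val, hres, map_mul,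
      map_pow, hp]
  · simp only [AlgHom.comp_apply, overlapFirstLast, aeval_X, Matrix.cons_val, map_mul,
      map_pow, hinv]
    rw [hres]
    rw [map_mul] at hu
    have hst : (ψ₁ (X 0) * ψ₁ (X 1)) ^ (k + 2) ≠ 0 :=
      pow_ne_zero _ (left_ne_zero_of_mul_eq_one hu)
    apply mul_left_cancel₀ hst
    have hu' := congrArg (· ^ (k + 2)) hu
    simp only [mul_pow, one_pow] at hu' ⊢
    linear_combination ψ₁ (X 0) * hu' - ψ₁ (X 0) * hq

theorem separatedBy_first_last_one :
    SeparatedBy (chartFirst 1) (chartLast 1) (planeAwayMap (X 1)) overlapFirstLastOne := by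
  intro B _ _ _ ψ₁ ψ₂ heq hne
  obtain ⟨hp, hq⟩ := chart_first_last_relation le_rfl heq hne
  simp only [Nat.sub_self, pow_zero, pow_one, one_mul] at hq hp
  obtain ⟨θ, hθ, hres, hinv⟩ := exists_planeAway_lift _ ψ₁ hq
  refine ⟨θ, hθ, planeRing_algHom_ext ?_ ?_⟩
  · simp only [AlgHom.comp_apply, overlapFirstLastOne, aeval_X, Matrix.cons_val, hres, map_mul,
      map_pow, hp]
  · simp only [AlgHom.comp_apply, overlapFirstLastOne, aeval_X, Matrix.cons_val, hinv]

end ASing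
end

noncomputable section

/-! ### Sections and morphisms to affine schemes -/

section Sections

variable {R : Type} [CommRing R] {Z W : Scheme.{0}}

theorem toSections_top (σ : Z ⟶ Spec (CommRingCat.of R)) :
    toSections σ ⊤ = ((Scheme.ΓSpecIso (CommRingCat.of R)).inv ≫ σ.appTop).hom := by
  rw [toSections, Scheme.Hom.appTop, Scheme.Hom.app_eq_appLE]
  rfl

theorem toSections_comp (g : W ⟶ Z) (σ : Z ⟶ Spec (CommRingCat.of R)) :
    toSections (g ≫ σ) ⊤ = g.appTop.hom.comp (toSections σ ⊤) := by
  rw [toSections_top, toSections_top, Scheme.Hom.comp_appTop, ← Category.assoc,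
    CommRingCat.hom_comp]

theorem toSections_comp_specMap {A : Type} [CommRing A] (h : Z ⟶ Spec (CommRingCat.of A))
    (χ : R →+* A) :
    toSections (h ≫ Spec.map (CommRingCat.ofHom χ)) ⊤ = (toSections h ⊤).comp χ := by
  rw [toSections_top, toSections_top, Scheme.Hom.comp_appTop, ← Category.assoc,
    ← Scheme.ΓSpecIso_inv_naturality, Category.assoc, CommRingCat.hom_comp, CommRingCat.hom_ofHom]

theorem toSections_res (σ : Z ⟶ Spec (CommRingCat.of R)) {U V : Z.Opens} (i : V ⟶ U) :
    toSections σ V = (Z.presheaf.map i.op).hom.comp (toSections σ U) := by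
  have h := Scheme.Hom.appLE_map σ (U := ⊤) (V := U) le_top i.op
  exact congrArg (fun g => ((Scheme.ΓSpecIso (CommRingCat.of R)).inv ≫ g).hom) h.symm

theorem toSections_ι (σ : Z ⟶ Spec (CommRingCat.of R)) (U : Z.Opens) :
    toSections (U.ι ≫ σ) ⊤ = U.topIso.inv.hom.comp (toSections σ U) := by
  rw [toSections_comp, toSections_res σ (homOfLE le_top : U ⟶ ⊤), ← RingHom.comp_assoc,
    ← CommRingCat.hom_comp]
  congr 2
  exact Z.presheaf.map_comp (homOfLE (le_top : U ≤ ⊤)).op (eqToHom U.ι_image_top).op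

theorem toSections_injective {h h' : Z ⟶ Spec (CommRingCat.of R)}
    (e : toSections h ⊤ = toSections h' ⊤) : h = h' := by
  rw [toSections_top, toSections_top] at e
  exact ext_to_Spec (CommRingCat.hom_ext e)

theorem exists_toSections_eq (ψ : R →+* Γ(Z, ⊤)) :
    ∃ h : Z ⟶ Spec (CommRingCat.of R), toSections h ⊤ = ψ := by
  refine ⟨Z.toSpecΓ ≫ Spec.map (CommRingCat.ofHom ψ), ?_⟩
  rw [toSections_comp_specMap (A := Γ(Z, ⊤)) Z.toSpecΓ ψ, toSections_top, Scheme.toSpecΓ_appTop]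
  have : (Scheme.ΓSpecIso (CommRingCat.of Γ(Z, ⊤))).inv ≫ (Scheme.ΓSpecIso Γ(Z, ⊤)).hom = 𝟙 _ :=
    (Scheme.ΓSpecIso Γ(Z, ⊤)).inv_hom_id
  rw [this]
  rfl

theorem injective_toSections_of_isIso (h : Z ⟶ Spec (CommRingCat.of R)) [IsIso h] :
    Function.Injective (toSections h ⊤) := by
  rw [toSections_top]
  have : IsIso h.appTop := inferInstanceAs (IsIso (Scheme.Γ.map h.op))
  exact (ConcreteCategory.bijective_of_isIso
    ((Scheme.ΓSpecIso (CommRingCat.of R)).inv ≫ h.appTop)).1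

/-- On an integral scheme a nonzero section has nonempty nonvanishing locus, which meets every
nonempty open subset. -/
theorem appTop_injective_of_isOpenImmersion (g : W ⟶ Z) [IsOpenImmersion g] [Nonempty W]
    [AlgebraicGeometry.IsIntegral Z] : Function.Injective g.appTop.hom := by
  rw [injective_iff_map_eq_zero]
  intro a ha
  rw [← basicOpen_eq_bot_iff]
  by_contra h
  have hr : (g.opensRange : Set Z).Nonempty := Set.range_nonempty _
  obtain ⟨_, ⟨w, rfl⟩, hw⟩ := nonempty_preirreducible_inter g.opensRange.2 (Z.basicOpen a).2 hr
    ((TopologicalSpace.Opens.ne_bot_iff_nonempty _).1 h)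
  have hw' : w ∈ g ⁻¹ᵁ Z.basicOpen a := hw
  rw [Scheme.preimage_basicOpen_top] at hw'
  change w ∈ W.basicOpen (g.appTop.hom a) at hw'
  rw [ha, Scheme.basicOpen_zero] at hw'
  exact hw'

end Sections

/-! ### Gluing of morphisms and of schemes -/

/-- Morphisms over a base can be constructed locally if they are unique. -/
theorem existsUnique_lift_of_local {X Z S : Scheme.{0}} (f : X ⟶ S) (σ : Z ⟶ S)
    (hloc : ∀ z : Z, ∃ U : Z.Opens, z ∈ U ∧ ∃ h : U.toScheme ⟶ X, h ≫ f = U.ι ≫ σ)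
    (huniq : ∀ (W : Scheme.{0}) (g : W ⟶ Z) [IsOpenImmersion g] (h h' : W ⟶ X),
      h ≫ f = g ≫ σ → h' ≫ f = g ≫ σ → h = h') : ∃! β : Z ⟶ X, β ≫ f = σ := by
  choose U hU h hh using hloc
  let 𝒰 : Z.OpenCover :=
    { I₀ := Z
      X := fun z => (U z).toScheme
      f := fun z => (U z).ι
      mem₀ := by
        rw [Scheme.presieve₀_mem_precoverage_iff]
        exact ⟨fun z => ⟨z, by simpa using hU z⟩, inferInstance⟩ }
  refine ⟨𝒰.glueMorphisms h fun x y => ?_, ?_, ?_⟩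
  · refine huniq _ (Limits.pullback.fst (𝒰.f x) (𝒰.f y) ≫ 𝒰.f x) _ _ ?_ ?_
    · rw [Category.assoc, hh, Category.assoc]
    · rw [Limits.pullback.condition, Category.assoc, hh, Category.assoc]
  · refine 𝒰.hom_ext _ _ fun x => ?_
    rw [← Category.assoc, Scheme.Cover.ι_glueMorphisms]
    exact hh x
  · intro β hβ
    refine 𝒰.hom_ext _ _ fun x => ?_
    rw [Scheme.Cover.ι_glueMorphisms]
    exact huniq _ (U x).ι _ _ (by rw [Category.assoc, hβ]) (hh x)

/-- A scheme covered by two integral open subschemes with nonempty intersection is integral. -/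
theorem isIntegral_of_two {X U₁ U₂ V : Scheme.{0}} (j₁ : U₁ ⟶ X) (j₂ : U₂ ⟶ X)
    [IsOpenImmersion j₁] [IsOpenImmersion j₂]
    [AlgebraicGeometry.IsIntegral U₁] [AlgebraicGeometry.IsIntegral U₂] [Nonempty V]
    (a₁ : V ⟶ U₁) (a₂ : V ⟶ U₂) [IsOpenImmersion a₁] [IsOpenImmersion a₂]
    (h : a₁ ≫ j₁ = a₂ ≫ j₂) (hcov : ∀ x : X, x ∈ Set.range j₁ ∨ x ∈ Set.range j₂) :
    AlgebraicGeometry.IsIntegral X := by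
  have hVr : Set.range (a₁ ≫ j₁) = Set.range (a₂ ≫ j₂) := by rw [h]
  have meets {U : Scheme.{0}} [AlgebraicGeometry.IsIntegral U] (j : U ⟶ X) (a : V ⟶ U)
      [IsOpenImmersion a] (O : Set X) (hO : IsOpen O) (x : X) (hx : x ∈ O) (hxj : x ∈ Set.range j) :
      ((a ≫ j) ⁻¹' O).Nonempty := by
    obtain ⟨u, rfl⟩ := hxj
    obtain ⟨_, ⟨v, rfl⟩, hv⟩ := nonempty_preirreducible_inter (X := U) a.opensRange.2
      (hO.preimage j.continuous) (Set.range_nonempty _) ⟨u, hx⟩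
    exact ⟨v, by simpa using hv⟩
  -- V is dense in each of the two pieces, so every nonempty open set of X meets V; irreducibility
  -- of V then passes to X.
  have meets' (O : Set X) (hO : IsOpen O) (hne : O.Nonempty) : ((a₁ ≫ j₁) ⁻¹' O).Nonempty := by
    obtain ⟨x, hx⟩ := hne
    rcases hcov x with hj | hj
    · exact meets j₁ a₁ O hO x hx hj
    · rw [h]
      exact meets j₂ a₂ O hO x hx hj
  have : AlgebraicGeometry.IsIntegral V := isIntegral_of_isOpenImmersion a₁
  have hred : IsReduced X := by
    have (x : X) : _root_.IsReduced (X.presheaf.stalk x) := by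
      rcases hcov x with ⟨u, rfl⟩ | ⟨u, rfl⟩
      · exact isReduced_of_injective (j₁.stalkMap u).hom
          (ConcreteCategory.bijective_of_isIso (j₁.stalkMap u)).1
      · exact isReduced_of_injective (j₂.stalkMap u).hom
          (ConcreteCategory.bijective_of_isIso (j₂.stalkMap u)).1
    exact isReduced_of_isReduced_stalk X
  have : Nonempty X := ⟨(a₁ ≫ j₁) (Classical.arbitrary V)⟩
  have hirr : IrreducibleSpace X :=
    { isPreirreducible_univ := by
        rintro O₁ O₂ h₁ h₂ ⟨x, -, hx⟩ ⟨y, -, hy⟩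
        obtain ⟨v, hv₁, hv₂⟩ := nonempty_preirreducible_inter (X := V)
          (h₁.preimage (a₁ ≫ j₁).continuous) (h₂.preimage (a₁ ≫ j₁).continuous)
          (meets' O₁ h₁ ⟨x, hx⟩) (meets' O₂ h₂ ⟨y, hy⟩)
        exact ⟨_, trivial, hv₁, hv₂⟩
      toNonempty := inferInstance }
  exact isIntegral_of_irreducibleSpace_of_isReduced X

/-- Gluing two schemes over a base along a common open subscheme. -/
theorem exists_gluing_of_two {S U₁ U₂ V : Scheme.{0}} (f₁ : U₁ ⟶ S) (f₂ : U₂ ⟶ S)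
    (a₁ : V ⟶ U₁) (a₂ : V ⟶ U₂) [IsOpenImmersion a₁] [IsOpenImmersion a₂]
    (h : a₁ ≫ f₁ = a₂ ≫ f₂) :
    ∃ (X : Scheme.{0}) (f : X ⟶ S) (j₁ : U₁ ⟶ X) (j₂ : U₂ ⟶ X), IsOpenImmersion j₁ ∧
      IsOpenImmersion j₂ ∧ j₁ ≫ f = f₁ ∧ j₂ ≫ f = f₂ ∧ a₁ ≫ j₁ = a₂ ≫ j₂ ∧
      ∀ x : X, x ∈ Set.range j₁ ∨ x ∈ Set.range j₂ := by
  refine ⟨Limits.pushout a₁ a₂, Limits.pushout.desc f₁ f₂ h, Limits.pushout.inl _ _,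
    Limits.pushout.inr _ _, ?_, ?_, Limits.pushout.inl_desc _ _ _, Limits.pushout.inr_desc _ _ _,
    Limits.pushout.condition, fun x => ?_⟩
  · exact (Scheme.IsLocallyDirected.openCover (Limits.span a₁ a₂)).map_prop Limits.WalkingSpan.left
  · exact (Scheme.IsLocallyDirected.openCover (Limits.span a₁ a₂)).map_prop Limits.WalkingSpan.right
  · obtain ⟨i, xi, rfl⟩ := Scheme.IsLocallyDirected.ι_jointly_surjective (Limits.span a₁ a₂) x
    rcases i with _ | _ | _
    · left
      refine ⟨a₁ xi, ?_⟩
      have hw := Limits.colimit.w (Limits.span a₁ a₂) Limits.WalkingSpan.Hom.fst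
      exact (Scheme.Hom.comp_apply a₁ (Limits.pushout.inl a₁ a₂) xi).symm.trans
        (congrArg (fun g : V ⟶ Limits.pushout a₁ a₂ => g xi) hw)
    · exact Or.inl ⟨xi, rfl⟩
    · exact Or.inr ⟨xi, rfl⟩

end

noncomputable section

namespace ASing

open MvPolynomial

/-! ### Charts of a scheme over the surface -/

variable {n : ℕ}

/-- The generic point of `Z` is not sent to the singular point of the surface. -/
def Nondegenerate {Z : Scheme.{0}} (σ : Z ⟶ Surface n) : Prop :=
  ∃ i, toSections σ ⊤ (coord n i) ≠ 0

theorem Nondegenerate.comp {Z W : Scheme.{0}} [AlgebraicGeometry.IsIntegral Z] [Nonempty W]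
    {σ : Z ⟶ Surface n} (h : Nondegenerate σ) (g : W ⟶ Z) [IsOpenImmersion g] :
    Nondegenerate (g ≫ σ) := by
  obtain ⟨i, hi⟩ := h
  refine ⟨i, fun h0 => hi ?_⟩
  rw [toSections_comp, RingHom.comp_apply] at h0
  exact appTop_injective_of_isOpenImmersion g (h0.trans (map_zero _).symm)

theorem nondegenerate_of_locallyFree (hn : 1 ≤ n) {Z : Scheme.{0}}
    [AlgebraicGeometry.IsIntegral Z] {σ : Z ⟶ Surface n}
    (h : PullbackModTorsionLocallyFree (Der n) σ 2) : Nondegenerate σ := by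
  obtain ⟨U, -, hz, hU⟩ := h (Classical.arbitrary Z)
  have : Nonempty U := ⟨⟨_, hz⟩⟩
  obtain ⟨i, hi⟩ := exists_coord_ne_zero_of_freeModTorsion _ hn hU
  refine ⟨i, fun h0 => hi ?_⟩
  rw [toSections_res σ (homOfLE le_top : U ⟶ ⊤), RingHom.comp_apply, h0, map_zero]

section Separated

variable {A₁ A₂ V : Type} [CommRing A₁] [CommRing A₂] [CommRing V]
    [Algebra ℂ A₁] [Algebra ℂ A₂] [Algebra ℂ V]
    {c₁ : SurfaceRing n →ₐ[ℂ] A₁} {c₂ : SurfaceRing n →ₐ[ℂ] A₂}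
    {o₁ : A₁ →ₐ[ℂ] V} {o₂ : A₂ →ₐ[ℂ] V}

/-- Morphisms to affine schemes are ring maps into global sections, and Γ(Z, ⊤) is a domain, so the
algebraic separation property applies directly. -/
theorem SeparatedBy.exists_hom (hs : SeparatedBy c₁ c₂ o₁ o₂) {Z : Scheme.{0}}
    [AlgebraicGeometry.IsIntegral Z] {h₁ : Z ⟶ Spec (CommRingCat.of A₁)}
    {h₂ : Z ⟶ Spec (CommRingCat.of A₂)} (h : h₁ ≫ specMap c₁ = h₂ ≫ specMap c₂)
    (hne : Nondegenerate (h₁ ≫ specMap c₁)) :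
    ∃ θ : Z ⟶ Spec (CommRingCat.of V), θ ≫ specMap o₁ = h₁ ∧ θ ≫ specMap o₂ = h₂ := by
  have heq := congrArg (fun σ => toSections σ ⊤) h
  simp only [toSections_comp_specMap] at heq
  -- The ℂ-structure is taken from h₁; h₂ respects it because the two composites to the surface
  -- coincide.
  let _ : Algebra ℂ Γ(Z, ⊤) := ((toSections h₁ ⊤).comp (algebraMap ℂ A₁)).toAlgebra
  let ψ₁ : A₁ →ₐ[ℂ] Γ(Z, ⊤) := { toSections h₁ ⊤ with commutes' := fun _ => rfl }
  let ψ₂ : A₂ →ₐ[ℂ] Γ(Z, ⊤) :=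
    { toSections h₂ ⊤ with
      commutes' := fun r => by
        have := DFunLike.congr_fun heq (algebraMap ℂ _ r)
        simp at this
        exact this.symm }
  obtain ⟨θ, hθ₁, hθ₂⟩ := hs Γ(Z, ⊤) ψ₁ ψ₂ (AlgHom.ext fun x => DFunLike.congr_fun heq x) (by
    obtain ⟨i, hi⟩ := hne
    rw [toSections_comp_specMap] at hi
    exact ⟨i, hi⟩)
  obtain ⟨t, ht⟩ := exists_toSections_eq θ.toRingHom
  refine ⟨t, toSections_injective ?_, toSections_injective ?_⟩
  · rw [toSections_comp_specMap, ht]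
    exact RingHom.ext fun x => DFunLike.congr_fun hθ₁ x
  · rw [toSections_comp_specMap, ht]
    exact RingHom.ext fun x => DFunLike.congr_fun hθ₂ x

theorem nondegenerate_specMap (h : c₁ (coord n 0) ≠ 0) : Nondegenerate (specMap c₁) := by
  refine ⟨0, ?_⟩
  have := toSections_comp_specMap (𝟙 (Spec (CommRingCat.of A₁))) c₁.toRingHom
  rw [Category.id_comp] at this
  rw [this, RingHom.comp_apply, toSections_top]
  intro h0
  apply h
  have hinj : Function.Injective ((Scheme.ΓSpecIso (CommRingCat.of A₁)).inv).hom :=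
    (ConcreteCategory.bijective_of_isIso (Scheme.ΓSpecIso (CommRingCat.of A₁)).inv).1
  apply hinj
  rw [map_zero]
  simpa using h0

/-- The true fibre product is a nonempty open subscheme of the integral Spec A₁, so separation maps
it to Spec V. This supplies the lifts required of Spec V, and they are unique because Spec V → Spec
A₁ is a monomorphism. -/
theorem SeparatedBy.isPullback [IsDomain A₁] [Nontrivial V] (hs : SeparatedBy c₁ c₂ o₁ o₂)
    (hc : c₁ (coord n 0) ≠ 0) [IsOpenImmersion (specMap o₁)]
    {X : Scheme.{0}} {f : X ⟶ Surface n} {j₁ : Spec (CommRingCat.of A₁) ⟶ X}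
    {j₂ : Spec (CommRingCat.of A₂) ⟶ X} [IsOpenImmersion j₂]
    (h₁ : j₁ ≫ f = specMap c₁) (h₂ : j₂ ≫ f = specMap c₂)
    (h : specMap o₁ ≫ j₁ = specMap o₂ ≫ j₂) : IsPullback (specMap o₁) (specMap o₂) j₁ j₂ := by
  let p₁ := Limits.pullback.fst j₁ j₂
  let p₂ := Limits.pullback.snd j₁ j₂
  have hne : Nonempty ↑(Limits.pullback j₁ j₂) :=
    ⟨Limits.pullback.lift _ _ h (Classical.arbitrary (Spec (CommRingCat.of V)))⟩
  have : AlgebraicGeometry.IsIntegral (Spec (CommRingCat.of A₁)) := inferInstance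
  have : AlgebraicGeometry.IsIntegral (Limits.pullback j₁ j₂) := isIntegral_of_isOpenImmersion p₁
  obtain ⟨θ, hθ₁, hθ₂⟩ := hs.exists_hom (h₁ := p₁) (h₂ := p₂) (by
    rw [← h₁, ← h₂, ← Category.assoc, ← Category.assoc, Limits.pullback.condition])
    ((nondegenerate_specMap hc).comp p₁)
  refine ⟨⟨h⟩, ⟨Limits.PullbackCone.IsLimit.mk h
    (fun s => Limits.pullback.lift s.fst s.snd s.condition ≫ θ) (fun s => ?_) (fun s => ?_)
    (fun s m hm₁ _ => ?_)⟩⟩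
  · rw [Category.assoc, hθ₁, Limits.pullback.lift_fst]
  · rw [Category.assoc, hθ₂, Limits.pullback.lift_snd]
  · rw [← cancel_mono (specMap o₁), hm₁, Category.assoc, hθ₁, Limits.pullback.lift_fst]

end Separated

/-- A homomorphism of `ℂ`-algebras out of the surface ring. -/
structure Chart (n : ℕ) where
  /-- The coordinate ring of the chart. -/
  A : Type
  [commRing : CommRing A]
  [algebra : Algebra ℂ A]
  /-- The homomorphism defining the projection of the chart to the surface. -/
  hom : SurfaceRing n →ₐ[ℂ] A

attribute [instance] Chart.commRing Chart.algebra

/-- The affine scheme of a chart. -/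
abbrev Chart.scheme (c : Chart n) : Scheme.{0} := Spec (CommRingCat.of c.A)

/-- Two open charts of a scheme over the surface meet along a separating overlap. -/
def Chart.Overlap {X : Scheme.{0}} {c d : Chart n} (j : c.scheme ⟶ X) (k : d.scheme ⟶ X) : Prop :=
  ∃ (V : Type) (_ : CommRing V) (_ : Algebra ℂ V) (o₁ : c.A →ₐ[ℂ] V) (o₂ : d.A →ₐ[ℂ] V),
    SeparatedBy c.hom d.hom o₁ o₂ ∧ specMap o₁ ≫ j = specMap o₂ ≫ k

theorem Chart.Overlap.symm {X : Scheme.{0}} {c d : Chart n} {j : c.scheme ⟶ X}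
    {k : d.scheme ⟶ X} (h : Chart.Overlap j k) : Chart.Overlap k j := by
  obtain ⟨V, i₁, i₂, o₁, o₂, h, h'⟩ := h
  exact ⟨V, i₁, i₂, o₂, o₁, h.symm, h'.symm⟩

/-- The pullback of the derivations to an open subscheme of a chart is free of rank two. -/
def Chart.IsFree (c : Chart n) : Prop :=
  ∀ (B : Type) [CommRing B] [IsDomain B] (ψ : c.A →+* B), Function.Injective ψ →
    FreeModTorsion (ψ.comp c.hom.toRingHom) (Der n) 2

/-- Freeness on the charts gives local freeness. For the universal property, local lifts exist by
`hloc`, and two lifts agree because near each point they land in charts i and k and so factor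
through a common overlap. -/
theorem isDerBlowUp_of_charts (hn : 1 ≤ n) {X : Scheme.{0}} [AlgebraicGeometry.IsIntegral X]
    (f : X ⟶ Surface n) {ι : Type} (c : ι → Chart n) (j : ∀ i, (c i).scheme ⟶ X)
    [∀ i, IsOpenImmersion (j i)] (hj : ∀ i, j i ≫ f = specMap (c i).hom)
    (hcov : ∀ x, ∃ i, x ∈ Set.range (j i)) (hsep : ∀ i k, Chart.Overlap (j i) (j k))
    (hfree : ∀ i, (c i).IsFree)
    (hloc : ∀ (Z : Scheme.{0}) [AlgebraicGeometry.IsIntegral Z] (σ : Z ⟶ Surface n),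
      PullbackModTorsionLocallyFree (Der n) σ 2 → ∀ z : Z, ∃ U : Z.Opens, z ∈ U ∧
        ∃ (i : ι) (h : U.toScheme ⟶ (c i).scheme), h ≫ specMap (c i).hom = U.ι ≫ σ) :
    IsDerBlowUp n f where
  isIntegral := inferInstance
  locallyFree := by
    rw [finrank_der]
    intro x
    obtain ⟨i, hx⟩ := hcov x
    refine ⟨(j i).opensRange, isAffineOpen_opensRange (j i), hx, ?_⟩
    have hne : Nonempty (j i).opensRange := ⟨⟨x, hx⟩⟩
    let U := (j i).opensRange
    let l : U.toScheme ⟶ (c i).scheme := (j i).isoOpensRange.inv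
    have : IsIso l := inferInstanceAs (IsIso (j i).isoOpensRange.inv)
    have hl : l ≫ specMap (c i).hom = U.ι ≫ f := by
      rw [← hj, ← Category.assoc, Scheme.Hom.isoOpensRange_inv_comp]
    have h := congrArg (fun σ => toSections σ ⊤) hl
    simp only [toSections_comp_specMap, toSections_ι] at h
    let ψ : (c i).A →+* Γ(X, U) := U.topIso.hom.hom.comp (toSections l ⊤)
    have hψ : toSections f U = ψ.comp (c i).hom.toRingHom := by
      rw [RingHom.comp_assoc]
      change toSections f U = U.topIso.hom.hom.comp ((toSections l ⊤).comp (c i).hom.toRingHom)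
      rw [h, ← RingHom.comp_assoc, ← CommRingCat.hom_comp, Iso.inv_hom_id]
      rfl
    rw [hψ]
    refine hfree i _ ψ ?_
    have h₁ : Function.Injective U.topIso.hom.hom :=
      (ConcreteCategory.bijective_of_isIso U.topIso.hom).1
    exact h₁.comp (injective_toSections_of_isIso l)
  existsUnique_lift := by
    intro Z _ σ hσ
    rw [finrank_der] at hσ
    have hnd := nondegenerate_of_locallyFree hn hσ
    refine existsUnique_lift_of_local f σ (fun z => ?_) ?_
    · obtain ⟨U, hz, i, h, hh⟩ := hloc Z σ hσ z
      exact ⟨U, hz, h ≫ j i, by rw [Category.assoc, hj, hh]⟩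
    · intro W g _ h h' hh hh'
      refine Scheme.hom_ext_of_forall _ _ fun w => ?_
      obtain ⟨i, hi⟩ := hcov (h w)
      obtain ⟨k, hk⟩ := hcov (h' w)
      let V : W.Opens := h ⁻¹ᵁ (j i).opensRange ⊓ h' ⁻¹ᵁ (j k).opensRange
      have hwV : w ∈ V := ⟨hi, hk⟩
      refine ⟨V, hwV, ?_⟩
      have : Nonempty V := ⟨⟨w, hwV⟩⟩
      have : AlgebraicGeometry.IsIntegral V := isIntegral_of_isOpenImmersion (V.ι ≫ g)
      have r₁ : Set.range (V.ι ≫ h) ⊆ Set.range (j i) := by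
        rintro _ ⟨v, rfl⟩
        exact v.2.1
      have r₂ : Set.range (V.ι ≫ h') ⊆ Set.range (j k) := by
        rintro _ ⟨v, rfl⟩
        exact v.2.2
      have e₁ := IsOpenImmersion.lift_fac (j i) (V.ι ≫ h) r₁
      have e₂ := IsOpenImmersion.lift_fac (j k) (V.ι ≫ h') r₂
      set l₁ := IsOpenImmersion.lift (j i) (V.ι ≫ h) r₁
      set l₂ := IsOpenImmersion.lift (j k) (V.ι ≫ h') r₂
      have s₁ : l₁ ≫ specMap (c i).hom = (V.ι ≫ g) ≫ σ := by
        rw [← hj, ← Category.assoc, e₁, Category.assoc, hh, Category.assoc]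
      have s₂ : l₂ ≫ specMap (c k).hom = (V.ι ≫ g) ≫ σ := by
        rw [← hj, ← Category.assoc, e₂, Category.assoc, hh', Category.assoc]
      obtain ⟨_, _, _, o₁, o₂, hs, ho⟩ := hsep i k
      obtain ⟨θ, hθ₁, hθ₂⟩ := hs.exists_hom (s₁.trans s₂.symm) (by
        rw [s₁]
        exact hnd.comp _)
      rw [← e₁, ← e₂, ← hθ₁, ← hθ₂, Category.assoc, Category.assoc, ho]

/-! ### Local lifts to the charts -/

/-- Locally, a morphism pulling back the derivations to a locally free module of rank two lifts to
one of the charts. -/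
theorem exists_local_lift (hn : 1 ≤ n) {Z : Scheme.{0}} [AlgebraicGeometry.IsIntegral Z]
    {σ : Z ⟶ Surface n} (hσ : PullbackModTorsionLocallyFree (Der n) σ 2) (z : Z) :
    ∃ U : Z.Opens, z ∈ U ∧
      ((∃ h : U.toScheme ⟶ Plane, h ≫ specMap (chartFirst n) = U.ι ≫ σ) ∨
       (∃ h : U.toScheme ⟶ Plane, h ≫ specMap (chartLast n) = U.ι ≫ σ) ∨
       (∃ (hn : 2 ≤ n) (h : U.toScheme ⟶ Surface (n - 2)),
          h ≫ specMap (chartMiddle n hn) = U.ι ≫ σ)) := by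
  obtain ⟨i₀, hi₀⟩ := nondegenerate_of_locallyFree hn hσ
  obtain ⟨U, -, hz, hU⟩ := hσ z
  have : Nonempty U := ⟨⟨z, hz⟩⟩
  obtain ⟨m, c, hsum, hm⟩ := exists_minors_of_freeModTorsion _ hn hU
  -- If every minor were a nonunit in the local ring at z, so would be their combination, which
  -- equals 1.
  obtain ⟨k, hk⟩ : ∃ k, z ∈ Z.basicOpen (m k) := by
    by_contra! h
    have h1 : ∑ k, Z.presheaf.germ U z hz (c k) * Z.presheaf.germ U z hz (m k) = 1 := by
      rw [← map_one (Z.presheaf.germ U z hz).hom, ← hsum, map_sum]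
      simp
    have h2 : ∑ k, Z.presheaf.germ U z hz (c k) * Z.presheaf.germ U z hz (m k) ∈
        IsLocalRing.maximalIdeal (Z.presheaf.stalk z) := by
      refine sum_mem fun k _ => Ideal.mul_mem_left _ _ ?_
      rw [IsLocalRing.mem_maximalIdeal, mem_nonunits_iff, ← Scheme.mem_basicOpen]
      exact h k
    rw [h1] at h2
    exact (Ideal.ne_top_iff_one _).1 (IsLocalRing.maximalIdeal.isMaximal _).ne_top h2
  let W := Z.basicOpen (m k)
  have : Nonempty W := ⟨⟨z, hk⟩⟩
  let ρ : Γ(Z, U) →+* Γ(Z, W) := (Z.presheaf.map (homOfLE (Z.basicOpen_le (m k))).op).hom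
  obtain ⟨v, hv⟩ : ∃ v : Γ(Z, W), ρ (m k) * v = 1 :=
    (RingedSpace.isUnit_res_basicOpen Z.toRingedSpace (m k)).exists_right_inv
  have hρ : toSections σ W = ρ.comp (toSections σ U) := toSections_res σ _
  let _ : Algebra ℂ Γ(Z, W) := ((toSections σ W).comp (algebraMap ℂ (SurfaceRing n))).toAlgebra
  let φ : SurfaceRing n →ₐ[ℂ] Γ(Z, W) := { toSections σ W with commutes' := fun _ => rfl }
  have hφ (r) : φ r = ρ (toSections σ U r) := DFunLike.congr_fun hρ r
  have hne : ∃ i, φ (coord n i) ≠ 0 := by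
    refine ⟨i₀, fun h => hi₀ ?_⟩
    have h' : toSections σ W (coord n i₀) = 0 := h
    rw [toSections_res σ (homOfLE le_top : W ⟶ ⊤), RingHom.comp_apply] at h'
    exact map_injective_of_isIntegral Z (homOfLE le_top : W ⟶ ⊤) (h'.trans (map_zero _).symm)
  have hlift {A : Type} [CommRing A] [Algebra ℂ A] (χ : SurfaceRing n →ₐ[ℂ] A)
      (hχ : ∃ ψ : A →ₐ[ℂ] Γ(Z, W), ψ.comp χ = φ) :
      ∃ h : W.toScheme ⟶ Spec (CommRingCat.of A), h ≫ specMap χ = W.ι ≫ σ := by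
    obtain ⟨ψ, hψ⟩ := hχ
    obtain ⟨h, hh⟩ := exists_toSections_eq (W.topIso.inv.hom.comp ψ.toRingHom)
    refine ⟨h, toSections_injective ?_⟩
    rw [toSections_comp_specMap, hh, toSections_ι, RingHom.comp_assoc]
    congr 1
    exact RingHom.ext fun x => DFunLike.congr_fun hψ x
  have hdiv {a b d : Γ(Z, U)} (h : a * m k = d * b) : ρ a = ρ d * (ρ b * v) := by
    have := congrArg ρ h
    rw [map_mul, map_mul] at this
    linear_combination v * this - ρ a * hv
  refine ⟨W, hk, ?_⟩
  rcases hm k with ⟨b, h₁, h₂⟩ | ⟨b, h₁, h₂⟩ | ⟨a, b, h₁, h₂, h₃, h₄⟩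
  · refine Or.inl (hlift _ (exists_comp_chartFirst_eq φ (ρ b * v) ?_ ?_))
    · simpa only [hφ] using hdiv h₁
    · simpa only [hφ, ← map_pow] using hdiv h₂
  · refine Or.inr (Or.inl (hlift _ (exists_comp_chartLast_eq φ (ρ b * v) ?_ ?_)))
    · simpa only [hφ] using hdiv h₁
    · simpa only [hφ, ← map_pow] using hdiv h₂
  -- For n = 1 there is no middle chart: the relations yⁿm = xb and zm = yb become those of the
  -- first chart.
  · rcases hn.lt_or_eq with hn' | rfl
    · refine Or.inr (Or.inr ⟨hn', hlift _
        (exists_comp_chartMiddle_eq hn' φ hne (ρ a * v) (ρ b * v) ?_ ?_ ?_)⟩)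
      · simpa only [hφ] using hdiv h₁
      · simpa only [hφ] using hdiv h₂
      · simpa only [hφ, ← map_pow] using hdiv h₃
    · refine Or.inl (hlift _ (exists_comp_chartFirst_eq φ (ρ b * v) ?_ ?_))
      · rw [pow_one] at h₃
        simpa only [hφ] using hdiv h₃
      · simpa only [hφ, pow_one] using hdiv h₁

theorem surfaceHom_injective_ne_zero {B A : Type} [CommRing A] [CommRing B] [Algebra ℂ A]
    {χ : SurfaceRing n →ₐ[ℂ] A} {ψ : A →+* B} (hψ : Function.Injective ψ)
    (h : ∀ i, χ (coord n i) ≠ 0) (i : Fin 3) : ψ.comp χ.toRingHom (coord n i) ≠ 0 := by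
  intro h0
  exact h i (hψ (h0.trans (map_zero _).symm))

theorem chartFirst_coord_ne_zero (i : Fin 3) : chartFirst n (coord n i) ≠ 0 := by
  rw [chartFirst_coord]
  fin_cases i <;> simp

theorem chartLast_coord_ne_zero (i : Fin 3) : chartLast n (coord n i) ≠ 0 := by
  rw [chartLast_coord]
  fin_cases i <;> simp

theorem chartMiddle_coord_ne_zero (hn : 2 ≤ n) (i : Fin 3) :
    chartMiddle n hn (coord n i) ≠ 0 := by
  rw [chartMiddle_coord]
  fin_cases i <;> simp [coord_ne_zero]

theorem isFree_chartFirst (hn : 1 ≤ n) : (Chart.mk _ (chartFirst n)).IsFree := by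
  intro B _ _ ψ hψ
  refine freeModTorsion_der_first _ hn
    (surfaceHom_injective_ne_zero hψ chartFirst_coord_ne_zero) (t := ψ (X 1)) ?_
  change ψ (chartFirst n _) = ψ (chartFirst n _) * _
  rw [chartFirst_coord, chartFirst_coord]
  exact map_mul ψ _ _

theorem isFree_chartLast (hn : 1 ≤ n) : (Chart.mk _ (chartLast n)).IsFree := by
  intro B _ _ ψ hψ
  refine freeModTorsion_der_last _ hn
    (surfaceHom_injective_ne_zero hψ chartLast_coord_ne_zero) (q := ψ (X 1)) ?_
  change ψ (chartLast n _) = ψ (chartLast n _) * _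
  rw [chartLast_coord, chartLast_coord]
  exact map_mul ψ _ _

theorem isFree_chartMiddle (hn : 2 ≤ n) : (Chart.mk _ (chartMiddle n hn)).IsFree := by
  intro B _ _ ψ hψ
  refine freeModTorsion_der_middle _
    (surfaceHom_injective_ne_zero hψ (chartMiddle_coord_ne_zero hn))
    (a := ψ (coord (n - 2) 0)) (b := ψ (coord (n - 2) 2)) ?_ ?_
  · change ψ (chartMiddle n hn _) = ψ (chartMiddle n hn _) * _
    rw [chartMiddle_coord, chartMiddle_coord]
    exact (map_mul ψ _ _).trans (mul_comm _ _)
  · change ψ (chartMiddle n hn _) = ψ (chartMiddle n hn _) * _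
    rw [chartMiddle_coord, chartMiddle_coord]
    exact (map_mul ψ _ _).trans (mul_comm _ _)

end ASing
end

noncomputable section

namespace ASing

open MvPolynomial

variable {n : ℕ}

/-! ### The overlaps are principal open subsets -/

theorem specMap_comp {A B C : Type} [CommRing A] [CommRing B] [CommRing C] [Algebra ℂ A]
    [Algebra ℂ B] [Algebra ℂ C] (φ : A →ₐ[ℂ] B) (ψ : B →ₐ[ℂ] C) :
    specMap (ψ.comp φ) = specMap ψ ≫ specMap φ := by
  rw [← Spec.map_comp]
  rfl

theorem specMap_id (A : Type) [CommRing A] [Algebra ℂ A] :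
    specMap (AlgHom.id ℂ A) = 𝟙 _ := by
  rw [← Spec.map_id]
  rfl

theorem isIso_specMap {A B : Type} [CommRing A] [CommRing B] [Algebra ℂ A] [Algebra ℂ B]
    {φ : A →ₐ[ℂ] B} {ψ : B →ₐ[ℂ] A} (h₁ : ψ.comp φ = AlgHom.id ℂ A)
    (h₂ : φ.comp ψ = AlgHom.id ℂ B) : IsIso (specMap φ) :=
  ⟨specMap ψ, by rw [← specMap_comp, h₂, specMap_id], by rw [← specMap_comp, h₁, specMap_id]⟩

theorem isDomain_localizationAway {A : Type} [CommRing A] [IsDomain A] {a : A} (ha : a ≠ 0) :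
    IsDomain (Localization.Away a) :=
  IsLocalization.isDomain_localization (powers_le_nonZeroDivisors_of_noZeroDivisors ha)

instance isOpenImmersion_specMap_away {A : Type} [CommRing A] [Algebra ℂ A] (a : A) :
    IsOpenImmersion (specMap (IsScalarTower.toAlgHom ℂ A (Localization.Away a))) :=
  IsOpenImmersion.of_isLocalization a

theorem planeAway_algHom_ext {g : PlaneRing} {B : Type} [CommRing B] [Algebra ℂ B]
    {θ θ' : PlaneAway g →ₐ[ℂ] B} (h : θ.comp (planeAwayMap g) = θ'.comp (planeAwayMap g)) :
    θ = θ' :=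
  IsLocalization.algHom_ext (Submonoid.powers g) h

theorem resFn_mul_invFn (g : PlaneRing) : resFn g g * invFn g = 1 :=
  IsLocalization.Away.mul_invSelf g

theorem overlapFirstMiddle_coord (hn : 2 ≤ n) (i : Fin 3) :
    overlapFirstMiddle n hn (coord (n - 2) i) = ![invFn (X 1), resFn (X 1) (X 0 * X 1),
      resFn (X 1) (X 0 ^ (n - 1) * X 1 ^ n)] i :=
  surfaceLift_coord ..

theorem overlapLastMiddle_coord (hn : 2 ≤ n) (i : Fin 3) :
    overlapLastMiddle n hn (coord (n - 2) i) = ![resFn (X 1) (X 0 ^ (n - 1) * X 1 ^ n),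
      resFn (X 1) (X 0 * X 1), invFn (X 1)] i :=
  surfaceLift_coord ..

theorem overlapFirstMiddle_comp_chartMiddle (hn : 2 ≤ n) :
    (overlapFirstMiddle n hn).comp (chartMiddle n hn) =
      (planeAwayMap (X 1)).comp (chartFirst n) := by
  have h := resFn_mul_invFn (X 1)
  rw [comp_chartMiddle_eq_iff]
  simp only [overlapFirstMiddle_coord, AlgHom.comp_apply, chartFirst_coord, Matrix.cons_val,
    IsScalarTower.coe_toAlgHom']
  refine ⟨?_, trivial, ?_⟩
  · rw [resFn, map_mul]
    linear_combination algebraMap PlaneRing (PlaneAway (X 1)) (X 0) * h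
  · rw [resFn, ← map_mul]
    congr 1
    obtain ⟨k, rfl⟩ := Nat.exists_eq_add_of_le' hn
    rw [show k + 2 - 1 = k + 1 from rfl]
    ring

theorem overlapLastMiddle_comp_chartMiddle (hn : 2 ≤ n) :
    (overlapLastMiddle n hn).comp (chartMiddle n hn) =
      (planeAwayMap (X 1)).comp (chartLast n) := by
  have h := resFn_mul_invFn (X 1)
  rw [comp_chartMiddle_eq_iff]
  simp only [overlapLastMiddle_coord, AlgHom.comp_apply, chartLast_coord, Matrix.cons_val,
    IsScalarTower.coe_toAlgHom']
  refine ⟨?_, trivial, ?_⟩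
  · rw [resFn, ← map_mul]
    congr 1
    obtain ⟨k, rfl⟩ := Nat.exists_eq_add_of_le' hn
    rw [show k + 2 - 1 = k + 1 from rfl]
    ring
  · rw [resFn, map_mul]
    linear_combination algebraMap PlaneRing (PlaneAway (X 1)) (X 0) * h

theorem overlapFirstLast_comp_chartLast (hn : 1 ≤ n) :
    (overlapFirstLast n).comp (chartLast n) = (planeAwayMap (X 0 * X 1)).comp (chartFirst n) := by
  have h := resFn_mul_invFn (X 0 * X 1)
  rw [comp_chartLast_eq_iff]
  obtain ⟨k, rfl⟩ := Nat.exists_eq_add_of_le' hn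
  simp only [overlapFirstLast, aeval_X, AlgHom.comp_apply, chartFirst_coord, Matrix.cons_val,
    IsScalarTower.coe_toAlgHom', resFn, map_mul, map_pow] at h ⊢
  generalize algebraMap PlaneRing (PlaneAway (X 0 * X 1)) (X 0) = s at *
  generalize algebraMap PlaneRing (PlaneAway (X 0 * X 1)) (X 1) = t at *
  generalize invFn (X 0 * X 1) = u at *
  have hu := congrArg (· ^ (k + 1)) h
  simp only [mul_pow, one_pow] at hu
  have hu' := congrArg (· ^ (k + 2)) hu
  simp only [mul_pow, one_pow] at hu'
  refine ⟨?_, ?_, trivial⟩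
  · linear_combination s * hu'
  · linear_combination s * t * hu

theorem overlapFirstLastOne_comp_chartLast :
    overlapFirstLastOne.comp (chartLast 1) = (planeAwayMap (X 1)).comp (chartFirst 1) := by
  have h := resFn_mul_invFn (X 1)
  rw [comp_chartLast_eq_iff]
  simp only [overlapFirstLastOne, aeval_X, AlgHom.comp_apply, chartFirst_coord, Matrix.cons_val,
    IsScalarTower.coe_toAlgHom', resFn, map_mul, map_pow] at h ⊢
  generalize algebraMap PlaneRing (PlaneAway (X 1)) (X 0) = s at *
  generalize algebraMap PlaneRing (PlaneAway (X 1)) (X 1) = t at *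
  generalize invFn (X 1) = u at *
  refine ⟨?_, ?_, by ring⟩
  · linear_combination s * (t * u + 1) * h
  · linear_combination s * t * h

/-- The overlap is also the principal open set {a ≠ 0} of A_{n-2}: the inverse of the transition map
is s = ac, t = 1/a, which separation extends to {t ≠ 0}. -/
theorem isOpenImmersion_overlapFirstMiddle (hn : 2 ≤ n) :
    IsOpenImmersion (specMap (overlapFirstMiddle n hn)) := by
  let L := Localization.Away (coord (n - 2) 0)
  have : IsDomain L := isDomain_localizationAway (coord_ne_zero _ _)
  let ψ₂ : SurfaceRing (n - 2) →ₐ[ℂ] L := IsScalarTower.toAlgHom ℂ _ L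
  let u : L := IsLocalization.Away.invSelf (coord (n - 2) 0)
  have hu : ψ₂ (coord (n - 2) 0) * u = 1 := IsLocalization.Away.mul_invSelf _
  have hψ₂ : Function.Injective ψ₂ := IsLocalization.injective L
    (powers_le_nonZeroDivisors_of_noZeroDivisors (coord_ne_zero (n - 2) 0))
  let ψ₁ : PlaneRing →ₐ[ℂ] L := aeval ![ψ₂ (coord (n - 2) 0) * ψ₂ (coord (n - 2) 1), u]
  have hψ : ψ₁.comp (chartFirst n) = ψ₂.comp (chartMiddle n hn) := by
    rw [comp_chartFirst_eq_iff]
    simp only [ψ₁, aeval_X, AlgHom.comp_apply, chartMiddle_coord, Matrix.cons_val, map_mul]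
    refine ⟨trivial, ?_, ?_⟩
    · linear_combination ψ₂ (coord (n - 2) 1) * hu
    · have h := congrArg ψ₂ (coord_relation (n - 2))
      have hn' := congrArg (· ^ n) hu
      rw [map_mul, map_pow] at h
      obtain ⟨k, rfl⟩ := Nat.exists_eq_add_of_le' hn
      generalize ψ₂ (coord (k + 2 - 2) 0) = a at h hn' hu ⊢
      generalize ψ₂ (coord (k + 2 - 2) 1) = c at h ⊢
      generalize ψ₂ (coord (k + 2 - 2) 2) = b at h ⊢
      replace h : a * b = c ^ (k + 1) := h
      simp only [mul_pow, one_pow] at hn'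
      linear_combination c ^ (k + 2) * u * hn' - c * u * h + b * c * hu
  obtain ⟨θ, hθ₁, hθ₂⟩ := separatedBy_first_middle hn L ψ₁ ψ₂ hψ ⟨0, by
    rw [chartFirst_coord]
    simp only [ψ₁, Matrix.cons_val, aeval_X]
    exact mul_ne_zero (left_ne_zero_of_mul_eq_one hu)
      ((map_ne_zero_iff ψ₂ hψ₂).2 (coord_ne_zero _ _))⟩
  have ho : overlapFirstMiddle n hn (coord (n - 2) 0) * resFn (X 1) (X 1) = 1 := by
    rw [overlapFirstMiddle_coord, mul_comm]
    exact resFn_mul_invFn (X 1)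
  have hunit : ∀ y : Submonoid.powers (coord (n - 2) 0), IsUnit (overlapFirstMiddle n hn y) := by
    rintro ⟨_, k, rfl⟩
    simpa using (IsUnit.of_mul_eq_one _ ho).pow k
  let χ : L →ₐ[ℂ] PlaneAway (X 1) := IsLocalization.liftAlgHom hunit
  have hχ (p) : χ (ψ₂ p) = overlapFirstMiddle n hn p := IsLocalization.lift_eq _ p
  have hχu : χ u = resFn (X 1) (X 1) := by
    have h := congrArg χ hu
    rw [map_mul, map_one, hχ] at h
    exact (IsUnit.of_mul_eq_one _ ho).mul_left_cancel (h.trans ho.symm)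
  have h₁ : θ.comp χ = AlgHom.id ℂ L := by
    refine IsLocalization.algHom_ext (Submonoid.powers (coord (n - 2) 0)) ?_
    refine AlgHom.ext fun p => ?_
    exact (congrArg θ (hχ p)).trans (DFunLike.congr_fun hθ₂ p)
  have h₂ : χ.comp θ = AlgHom.id ℂ (PlaneAway (X 1)) := by
    refine planeAway_algHom_ext ?_
    rw [AlgHom.comp_assoc, hθ₁, AlgHom.id_comp]
    have h := resFn_mul_invFn (X 1)
    refine planeRing_algHom_ext ?_ ?_
    · simp only [AlgHom.comp_apply, ψ₁, aeval_X, Matrix.cons_val, map_mul, hχ,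
        overlapFirstMiddle_coord, resFn, IsScalarTower.coe_toAlgHom'] at h ⊢
      linear_combination algebraMap PlaneRing (PlaneAway (X 1)) (X 0) * h
    · simp only [AlgHom.comp_apply, ψ₁, aeval_X, Matrix.cons_val, hχu]
      rfl
  have hiso : IsIso (specMap χ) := isIso_specMap h₁ h₂
  have hcomp : overlapFirstMiddle n hn = χ.comp ψ₂ := AlgHom.ext fun p => (hχ p).symm
  rw [hcomp, specMap_comp]
  infer_instance

/-- The automorphism of the surface exchanging `x` and `z`. -/
def surfaceSwap (n : ℕ) : SurfaceRing n →ₐ[ℂ] SurfaceRing n :=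
  surfaceLift n (coord n 2) (coord n 1) (coord n 0) (by rw [← coord_relation, mul_comm])

theorem surfaceSwap_comp_self (n : ℕ) :
    (surfaceSwap n).comp (surfaceSwap n) = AlgHom.id ℂ _ := by
  refine surfaceRing_algHom_ext fun i => ?_
  rw [AlgHom.comp_apply, surfaceSwap, surfaceLift_coord]
  fin_cases i <;> simp [surfaceLift_coord]

/-- Exchanging a and b on A_{n-2} turns the first transition map into the last one. -/
theorem isOpenImmersion_overlapLastMiddle (hn : 2 ≤ n) :
    IsOpenImmersion (specMap (overlapLastMiddle n hn)) := by
  have h : overlapLastMiddle n hn = (overlapFirstMiddle n hn).comp (surfaceSwap (n - 2)) := by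
    refine surfaceRing_algHom_ext fun i => ?_
    rw [AlgHom.comp_apply, surfaceSwap, surfaceLift_coord, overlapLastMiddle_coord]
    fin_cases i <;> simp [overlapFirstMiddle_coord]
  have := isIso_specMap (surfaceSwap_comp_self (n - 2)) (surfaceSwap_comp_self (n - 2))
  have := isOpenImmersion_overlapFirstMiddle hn
  rw [h, specMap_comp]
  infer_instance

/-- The substitution (s, t) ↦ (st², 1/t) is an involution of {t ≠ 0}, so the transition map is an
automorphism followed by the open inclusion. -/
theorem isOpenImmersion_overlapFirstLastOne : IsOpenImmersion (specMap overlapFirstLastOne) := by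
  have h := resFn_mul_invFn (X 1)
  obtain ⟨τ, hτ, hres, hinv⟩ := exists_planeAway_lift (X 1) overlapFirstLastOne
    (u := resFn (X 1) (X 1)) (by
      rw [overlapFirstLastOne, aeval_X, mul_comm]
      exact h)
  have hττ : τ.comp τ = AlgHom.id ℂ _ := by
    refine planeAway_algHom_ext ?_
    rw [AlgHom.comp_assoc, hτ, AlgHom.id_comp]
    refine planeRing_algHom_ext ?_ ?_
    · simp only [AlgHom.comp_apply, overlapFirstLastOne, aeval_X, Matrix.cons_val, hres, map_mul,
        map_pow, IsScalarTower.coe_toAlgHom', resFn] at h ⊢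
      linear_combination algebraMap PlaneRing (PlaneAway (X 1)) (X 0) *
        (algebraMap PlaneRing (PlaneAway (X 1)) (X 1) * invFn (X 1) + 1) * h
    · simp only [AlgHom.comp_apply, overlapFirstLastOne, aeval_X, Matrix.cons_val, hinv]
      rfl
  have := isIso_specMap hττ hττ
  rw [← hτ, specMap_comp]
  infer_instance

end ASing
end

noncomputable section

/-! ### Uniqueness of the blow-up -/

/-- The usual argument with universal properties; it carries the charts of one explicit model over
to every blow-up. -/
theorem IsModuleBlowUp.exists_iso {R : Type} [CommRing R] {M : Type} [AddCommGroup M] [Module R M]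
    {X Y : Scheme.{0}} {f : X ⟶ Spec (CommRingCat.of R)} {g : Y ⟶ Spec (CommRingCat.of R)}
    (hf : IsModuleBlowUp M f) (hg : IsModuleBlowUp M g) : ∃ e : X ≅ Y, e.hom ≫ g = f := by
  have := hf.isIntegral
  have := hg.isIntegral
  obtain ⟨a, ha, -⟩ := hg.existsUnique_lift X f hf.locallyFree
  obtain ⟨b, hb, -⟩ := hf.existsUnique_lift Y g hg.locallyFree
  refine ⟨⟨a, b, ?_, ?_⟩, ha⟩
  · exact (hf.existsUnique_lift X f hf.locallyFree).unique
      (by rw [Category.assoc, hb, ha]) (Category.id_comp f)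
  · exact (hg.existsUnique_lift Y g hg.locallyFree).unique
      (by rw [Category.assoc, ha, hb]) (Category.id_comp g)

namespace ASing

open MvPolynomial

variable {n : ℕ}

/-! ### The charts of the blow-up -/

/-- `X` is covered by the three charts of the blow-up, compatibly with the overlaps. -/
structure IsCoveredByThree (hn : 2 ≤ n) {X : Scheme.{0}} (f : X ⟶ Surface n) (j₁ : Plane ⟶ X)
    (j₂ : Surface (n - 2) ⟶ X) (j₃ : Plane ⟶ X) : Prop where
  isOpenImmersion₁ : IsOpenImmersion j₁
  isOpenImmersion₂ : IsOpenImmersion j₂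
  isOpenImmersion₃ : IsOpenImmersion j₃
  comp₁ : j₁ ≫ f = specMap (chartFirst n)
  comp₂ : j₂ ≫ f = specMap (chartMiddle n hn)
  comp₃ : j₃ ≫ f = specMap (chartLast n)
  cover : ∀ x : X, x ∈ Set.range j₁ ∨ x ∈ Set.range j₂ ∨ x ∈ Set.range j₃
  glue₁₂ : specMap (planeAwayMap (MvPolynomial.X 1)) ≫ j₁ = specMap (overlapFirstMiddle n hn) ≫ j₂
  glue₃₂ : specMap (planeAwayMap (MvPolynomial.X 1)) ≫ j₃ = specMap (overlapLastMiddle n hn) ≫ j₂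
  glue₁₃ : specMap (planeAwayMap (MvPolynomial.X 0 * MvPolynomial.X 1)) ≫ j₁ = specMap (overlapFirstLast n) ≫ j₃

theorem mem_range_comp_iso {U X Y : Scheme.{0}} {j : U ⟶ X} (e : X ≅ Y) {y : Y}
    (h : e.inv y ∈ Set.range j) : y ∈ Set.range (j ≫ e.hom) := by
  obtain ⟨u, hu⟩ := h
  refine ⟨u, ?_⟩
  rw [Scheme.Hom.comp_apply, hu, ← Scheme.Hom.comp_apply, e.inv_hom_id]
  rfl

theorem IsCoveredByThree.comp_iso {hn : 2 ≤ n} {X Y : Scheme.{0}} {f : X ⟶ Surface n}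
    {j₁ : Plane ⟶ X} {j₂ : Surface (n - 2) ⟶ X} {j₃ : Plane ⟶ X}
    (h : IsCoveredByThree hn f j₁ j₂ j₃) (e : X ≅ Y) {g : Y ⟶ Surface n} (he : e.hom ≫ g = f) :
    IsCoveredByThree hn g (j₁ ≫ e.hom) (j₂ ≫ e.hom) (j₃ ≫ e.hom) where
  isOpenImmersion₁ := have := h.isOpenImmersion₁; inferInstance
  isOpenImmersion₂ := have := h.isOpenImmersion₂; inferInstance
  isOpenImmersion₃ := have := h.isOpenImmersion₃; inferInstance
  comp₁ := by rw [Category.assoc, he, h.comp₁]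
  comp₂ := by rw [Category.assoc, he, h.comp₂]
  comp₃ := by rw [Category.assoc, he, h.comp₃]
  cover y := (h.cover (e.inv y)).imp (mem_range_comp_iso e)
    (Or.imp (mem_range_comp_iso e) (mem_range_comp_iso e))
  glue₁₂ := by rw [← Category.assoc, h.glue₁₂, Category.assoc]
  glue₃₂ := by rw [← Category.assoc, h.glue₃₂, Category.assoc]
  glue₁₃ := by rw [← Category.assoc, h.glue₁₃, Category.assoc]

theorem isDomain_planeAway {g : PlaneRing} (hg : g ≠ 0) : IsDomain (PlaneAway g) :=
  isDomain_localizationAway hg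

/-- The covering data contain only commuting squares; separation makes them cartesian, so the charts
meet in nothing more than the stated overlaps. -/
theorem IsCoveredByThree.isGluing {hn : 2 ≤ n} {X : Scheme.{0}} {f : X ⟶ Surface n}
    {j₁ : Plane ⟶ X} {j₂ : Surface (n - 2) ⟶ X} {j₃ : Plane ⟶ X}
    (h : IsCoveredByThree hn f j₁ j₂ j₃) :
    IsGluingOfThree j₁ j₂ j₃ (principalOpenIncl (MvPolynomial.X 1)) (specMap (overlapFirstMiddle n hn))
      (specMap (overlapLastMiddle n hn)) (principalOpenIncl (MvPolynomial.X 1))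
      (principalOpenIncl (MvPolynomial.X 0 * MvPolynomial.X 1)) (specMap (overlapFirstLast n)) := by
  have := h.isOpenImmersion₁
  have := h.isOpenImmersion₂
  have := h.isOpenImmersion₃
  have := isDomain_planeAway (X_ne_zero (R := ℂ) (1 : Fin 2))
  have := isDomain_planeAway (mul_ne_zero (X_ne_zero (R := ℂ) (0 : Fin 2)) (X_ne_zero 1))
  exact
  { isOpenImmersion₁ := inferInstance
    isOpenImmersion₂ := inferInstance
    isOpenImmersion₃ := inferInstance
    cover := h.cover
    overlap₁₂ := (separatedBy_first_middle hn).isPullback (chartFirst_coord_ne_zero 0)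
      h.comp₁ h.comp₂ h.glue₁₂
    overlap₂₃ := ((separatedBy_last_middle hn).isPullback (chartLast_coord_ne_zero 0)
      h.comp₃ h.comp₂ h.glue₃₂).flip
    overlap₁₃ := (separatedBy_first_last hn).isPullback (chartFirst_coord_ne_zero 0)
      h.comp₁ h.comp₃ h.glue₁₃ }

/-- The charts of the blow-up for `n ≥ 2`. -/
def threeCharts (hn : 2 ≤ n) : Fin 3 → Chart n
  | 0 => Chart.mk _ (chartFirst n)
  | 1 => Chart.mk _ (chartMiddle n hn)
  | 2 => Chart.mk _ (chartLast n)

theorem Chart.overlap_self {X : Scheme.{0}} {c : Chart n} (j : c.scheme ⟶ X)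
    (h : SeparatedBy c.hom c.hom (AlgHom.id ℂ _) (AlgHom.id ℂ _)) : Chart.Overlap j j :=
  ⟨c.A, _, _, _, _, h, rfl⟩

theorem IsCoveredByThree.isDerBlowUp {hn : 2 ≤ n} {X : Scheme.{0}}
    [AlgebraicGeometry.IsIntegral X] {f : X ⟶ Surface n}
    {j₁ : Plane ⟶ X} {j₂ : Surface (n - 2) ⟶ X} {j₃ : Plane ⟶ X}
    (h : IsCoveredByThree hn f j₁ j₂ j₃) : IsDerBlowUp n f := by
  have hn' : 1 ≤ n := by omega
  let j : ∀ i, (threeCharts hn i).scheme ⟶ X := fun i => match i with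
    | 0 => j₁
    | 1 => j₂
    | 2 => j₃
  have s₁₂ : Chart.Overlap (j 0) (j 1) := ⟨_, _, _, _, _, separatedBy_first_middle hn, h.glue₁₂⟩
  have s₃₂ : Chart.Overlap (j 2) (j 1) := ⟨_, _, _, _, _, separatedBy_last_middle hn, h.glue₃₂⟩
  have s₁₃ : Chart.Overlap (j 0) (j 2) := ⟨_, _, _, _, _, separatedBy_first_last hn, h.glue₁₃⟩
  have ho : ∀ i, IsOpenImmersion (j i) := by
    intro i
    fin_cases i
    exacts [h.isOpenImmersion₁, h.isOpenImmersion₂, h.isOpenImmersion₃]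
  refine isDerBlowUp_of_charts hn' f (threeCharts hn) j ?_ ?_ ?_ ?_ ?_
  · intro i
    fin_cases i
    exacts [h.comp₁, h.comp₂, h.comp₃]
  · intro x
    rcases h.cover x with hx | hx | hx
    exacts [⟨0, hx⟩, ⟨1, hx⟩, ⟨2, hx⟩]
  · intro i k
    fin_cases i <;> fin_cases k
    exacts [Chart.overlap_self _ (separatedBy_first_first hn'), s₁₂, s₁₃, s₁₂.symm,
      Chart.overlap_self _ (separatedBy_middle_middle hn), s₃₂.symm, s₁₃.symm, s₃₂,
      Chart.overlap_self _ (separatedBy_last_last hn')]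
  · intro i
    fin_cases i
    exacts [isFree_chartFirst hn', isFree_chartMiddle hn, isFree_chartLast hn']
  · intro Z _ σ hσ z
    obtain ⟨U, hz, ⟨l, hl⟩ | ⟨l, hl⟩ | ⟨_, l, hl⟩⟩ := exists_local_lift hn' hσ z
    exacts [⟨U, hz, 0, l, hl⟩, ⟨U, hz, 2, l, hl⟩, ⟨U, hz, 1, l, hl⟩]

/-- The set {st ≠ 0} lies in {t ≠ 0}, so the first chart passes to the middle one there; separation
of the last and middle charts then identifies the result with a map through {q ≠ 0}. Compatibility
of the outer charts is thus a consequence of the other two. -/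
theorem glue_first_last (hn : 2 ≤ n) {X : Scheme.{0}} {j₁ : Plane ⟶ X}
    {j₂ : Surface (n - 2) ⟶ X} {j₃ : Plane ⟶ X}
    (h₁₂ : specMap (planeAwayMap (MvPolynomial.X 1)) ≫ j₁ = specMap (overlapFirstMiddle n hn) ≫ j₂)
    (h₃₂ : specMap (planeAwayMap (MvPolynomial.X 1)) ≫ j₃ = specMap (overlapLastMiddle n hn) ≫ j₂) :
    specMap (planeAwayMap (MvPolynomial.X 0 * MvPolynomial.X 1)) ≫ j₁ = specMap (overlapFirstLast n) ≫ j₃ := by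
  have hx : (MvPolynomial.X 0 * MvPolynomial.X 1 : PlaneRing) ≠ 0 := mul_ne_zero (X_ne_zero 0) (X_ne_zero 1)
  have := isDomain_planeAway hx
  have hinj : Function.Injective (planeAwayMap (MvPolynomial.X 0 * MvPolynomial.X 1)) := IsLocalization.injective _
    (powers_le_nonZeroDivisors_of_noZeroDivisors hx)
  obtain ⟨θ, hθ, -, -⟩ := exists_planeAway_lift (MvPolynomial.X 1) (planeAwayMap (MvPolynomial.X 0 * MvPolynomial.X 1))
    -- This is s/(st), the inverse of t on {st ≠ 0}.
    (u := resFn (MvPolynomial.X 0 * MvPolynomial.X 1) (MvPolynomial.X 0) * invFn (MvPolynomial.X 0 * MvPolynomial.X 1)) (by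
      have h := resFn_mul_invFn (MvPolynomial.X 0 * MvPolynomial.X 1)
      simp only [resFn, map_mul, IsScalarTower.coe_toAlgHom'] at h ⊢
      linear_combination h)
  obtain ⟨θ', hθ'₁, hθ'₂⟩ := separatedBy_last_middle hn _ (overlapFirstLast n)
    (θ.comp (overlapFirstMiddle n hn)) (by
      rw [AlgHom.comp_assoc, overlapFirstMiddle_comp_chartMiddle, ← AlgHom.comp_assoc, hθ,
        overlapFirstLast_comp_chartLast (by omega)])
    ⟨0, by
      rw [← AlgHom.comp_apply, overlapFirstLast_comp_chartLast (by omega)]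
      exact (map_ne_zero_iff _ hinj).2 (chartFirst_coord_ne_zero 0)⟩
  rw [← hθ, specMap_comp, Category.assoc, h₁₂, ← Category.assoc, ← specMap_comp, ← hθ'₂,
    specMap_comp, Category.assoc, ← h₃₂, ← Category.assoc, ← specMap_comp, hθ'₁]

theorem exists_isCoveredByThree (hn : 2 ≤ n) :
    ∃ (X : Scheme.{0}) (f : X ⟶ Surface n) (j₁ : Plane ⟶ X) (j₂ : Surface (n - 2) ⟶ X)
      (j₃ : Plane ⟶ X), AlgebraicGeometry.IsIntegral X ∧ IsCoveredByThree hn f j₁ j₂ j₃ := by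
  have := isOpenImmersion_overlapFirstMiddle hn
  have := isOpenImmersion_overlapLastMiddle hn
  have := isDomain_planeAway (X_ne_zero (R := ℂ) (1 : Fin 2))
  obtain ⟨Y, g, i₁, i₂, hi₁, hi₂, hg₁, hg₂, hi, hY⟩ := exists_gluing_of_two
    (specMap (chartFirst n)) (specMap (chartMiddle n hn)) (specMap (planeAwayMap (MvPolynomial.X 1)))
    (specMap (overlapFirstMiddle n hn)) (by
      rw [← specMap_comp, ← specMap_comp, overlapFirstMiddle_comp_chartMiddle])
  have : AlgebraicGeometry.IsIntegral Y := isIntegral_of_two i₁ i₂ _ _ hi hY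
  -- The last chart is attached along its overlap with the middle chart only. This suffices because
  -- its overlap with the first chart lies inside the middle one, and no cocycle condition arises.
  obtain ⟨X, f, k, j₃, hk, hj₃, hf, hf₃, hkj, hX⟩ := exists_gluing_of_two
    g (specMap (chartLast n)) (specMap (overlapLastMiddle n hn) ≫ i₂)
    (specMap (planeAwayMap (MvPolynomial.X 1))) (by
      rw [Category.assoc, hg₂, ← specMap_comp, ← specMap_comp, overlapLastMiddle_comp_chartMiddle])
  have hglue₁₂ : specMap (planeAwayMap (MvPolynomial.X 1)) ≫ i₁ ≫ k =
      specMap (overlapFirstMiddle n hn) ≫ i₂ ≫ k := by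
    rw [← Category.assoc, hi, Category.assoc]
  have hglue₃₂ : specMap (planeAwayMap (MvPolynomial.X 1)) ≫ j₃ =
      specMap (overlapLastMiddle n hn) ≫ i₂ ≫ k := by
    rw [← hkj, Category.assoc]
  refine ⟨X, f, i₁ ≫ k, i₂ ≫ k, j₃, isIntegral_of_two k j₃ _ _ hkj hX,
    { isOpenImmersion₁ := inferInstance
      isOpenImmersion₂ := inferInstance
      isOpenImmersion₃ := inferInstance
      comp₁ := by rw [Category.assoc, hf, hg₁]
      comp₂ := by rw [Category.assoc, hf, hg₂]
      comp₃ := hf₃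
      cover := fun x => ?_
      glue₁₂ := hglue₁₂
      glue₃₂ := hglue₃₂
      glue₁₃ := glue_first_last hn hglue₁₂ hglue₃₂ }⟩
  rcases hX x with ⟨y, rfl⟩ | hx
  · rcases hY y with ⟨u, rfl⟩ | ⟨u, rfl⟩
    · exact Or.inl ⟨u, Scheme.Hom.comp_apply _ _ _⟩
    · exact Or.inr (Or.inl ⟨u, Scheme.Hom.comp_apply _ _ _⟩)
  · exact Or.inr (Or.inr hx)

theorem exists_isDerBlowUp_of_two_le (hn : 2 ≤ n) :
    ∃ (X : Scheme.{0}) (f : X ⟶ Surface n), IsDerBlowUp n f := by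
  obtain ⟨X, f, j₁, j₂, j₃, _, h⟩ := exists_isCoveredByThree hn
  exact ⟨X, f, h.isDerBlowUp⟩

theorem IsDerBlowUp.exists_isCoveredByThree (hn : 2 ≤ n) {X : Scheme.{0}} {f : X ⟶ Surface n}
    (hf : IsDerBlowUp n f) : ∃ (j₁ : Plane ⟶ X) (j₂ : Surface (n - 2) ⟶ X) (j₃ : Plane ⟶ X),
      IsCoveredByThree hn f j₁ j₂ j₃ := by
  obtain ⟨Y, g, j₁, j₂, j₃, _, h⟩ := ASing.exists_isCoveredByThree hn
  obtain ⟨e, he⟩ := IsModuleBlowUp.exists_iso h.isDerBlowUp hf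
  exact ⟨_, _, _, h.comp_iso e he⟩

/-! ### The case of `A₂` -/

/-- The isomorphism of the surface `a b = c` with the plane. -/
def surfaceZeroToPlane : SurfaceRing 0 →ₐ[ℂ] PlaneRing :=
  surfaceLift 0 (MvPolynomial.X 0) (MvPolynomial.X 0 * MvPolynomial.X 1) (MvPolynomial.X 1) (by ring)

/-- The inverse of `surfaceZeroToPlane`. -/
def planeToSurfaceZero : PlaneRing →ₐ[ℂ] SurfaceRing 0 :=
  aeval ![coord 0 0, coord 0 2]

theorem surfaceZeroToPlane_coord (i : Fin 3) :
    surfaceZeroToPlane (coord 0 i) = ![MvPolynomial.X 0, MvPolynomial.X 0 * MvPolynomial.X 1, MvPolynomial.X 1] i :=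
  surfaceLift_coord ..

theorem surfaceZeroToPlane_comp :
    surfaceZeroToPlane.comp planeToSurfaceZero = AlgHom.id ℂ _ := by
  refine planeRing_algHom_ext ?_ ?_ <;>
    simp [planeToSurfaceZero, surfaceZeroToPlane_coord]

theorem planeToSurfaceZero_comp :
    planeToSurfaceZero.comp surfaceZeroToPlane = AlgHom.id ℂ _ := by
  have h := coord_relation 0
  refine surfaceRing_algHom_ext fun i => ?_
  rw [AlgHom.comp_apply, surfaceZeroToPlane_coord]
  fin_cases i
  · simp [planeToSurfaceZero]
  · simpa [planeToSurfaceZero] using h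
  · simp [planeToSurfaceZero]

theorem surfaceZeroToPlane_comp_chartMiddle :
    surfaceZeroToPlane.comp (chartMiddle 2 le_rfl) = chartMiddleTwo := by
  refine surfaceRing_algHom_ext fun i => ?_
  rw [AlgHom.comp_apply, chartMiddle_coord, chartMiddleTwo, surfaceLift_coord]
  fin_cases i
  · simp [surfaceZeroToPlane_coord]
    ring
  · simp [surfaceZeroToPlane_coord]
  · simp [surfaceZeroToPlane_coord]
    ring

theorem overlapFirstMiddleTwo_comp_surfaceZeroToPlane :
    overlapFirstMiddleTwo.comp surfaceZeroToPlane = overlapFirstMiddle 2 le_rfl := by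
  have h : (overlapFirstMiddle 2 le_rfl).comp planeToSurfaceZero = overlapFirstMiddleTwo := ?_
  · rw [← h, AlgHom.comp_assoc, planeToSurfaceZero_comp, AlgHom.comp_id]
  refine planeRing_algHom_ext ?_ ?_
  · simp only [AlgHom.comp_apply, planeToSurfaceZero, overlapFirstMiddleTwo, aeval_X,
      Matrix.cons_val]
    exact overlapFirstMiddle_coord le_rfl 0
  · simp only [AlgHom.comp_apply, planeToSurfaceZero, overlapFirstMiddleTwo, aeval_X,
      Matrix.cons_val]
    exact (overlapFirstMiddle_coord le_rfl 2).trans (by simp)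

theorem overlapLastMiddleTwo_comp_surfaceZeroToPlane :
    overlapLastMiddleTwo.comp surfaceZeroToPlane = overlapLastMiddle 2 le_rfl := by
  have h : (overlapLastMiddle 2 le_rfl).comp planeToSurfaceZero = overlapLastMiddleTwo := ?_
  · rw [← h, AlgHom.comp_assoc, planeToSurfaceZero_comp, AlgHom.comp_id]
  refine planeRing_algHom_ext ?_ ?_
  · simp only [AlgHom.comp_apply, planeToSurfaceZero, overlapLastMiddleTwo, aeval_X,
      Matrix.cons_val]
    exact (overlapLastMiddle_coord le_rfl 0).trans (by simp)
  · simp only [AlgHom.comp_apply, planeToSurfaceZero, overlapLastMiddleTwo, aeval_X,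
      Matrix.cons_val]
    exact overlapLastMiddle_coord le_rfl 2

theorem isIso_surfaceZeroToPlane : IsIso (specMap surfaceZeroToPlane) :=
  isIso_specMap planeToSurfaceZero_comp surfaceZeroToPlane_comp

theorem isPullback_comp_surfaceZeroToPlane {V W X : Scheme.{0}} {a : V ⟶ W}
    {o : V ⟶ Plane} {j : W ⟶ X} {k : Surface 0 ⟶ X}
    (h : IsPullback a (o ≫ specMap surfaceZeroToPlane) j k) :
    IsPullback a o j (specMap surfaceZeroToPlane ≫ k) := by
  have h₁ : specMap planeToSurfaceZero ≫ specMap surfaceZeroToPlane = 𝟙 _ := by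
    rw [← specMap_comp, planeToSurfaceZero_comp, specMap_id]
  have h₂ : specMap surfaceZeroToPlane ≫ specMap planeToSurfaceZero = 𝟙 _ := by
    rw [← specMap_comp, surfaceZeroToPlane_comp, specMap_id]
  refine IsPullback.of_iso h (Iso.refl _) (Iso.refl _)
    ⟨specMap planeToSurfaceZero, specMap surfaceZeroToPlane, h₁, h₂⟩ (Iso.refl _) ?_ ?_ ?_ ?_
  · simp
  · simp [h₂]
  · simp
  · simp [reassoc_of% h₁]

/-- For n = 2 the middle chart is A₀, where c = ab can be eliminated; the general gluing is
transported along this isomorphism with the plane. -/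
theorem IsCoveredByThree.isGluing_two {X : Scheme.{0}} {f : X ⟶ Surface 2}
    {j₁ : Plane ⟶ X} {j₂ : Surface 0 ⟶ X} {j₃ : Plane ⟶ X}
    (h : IsCoveredByThree le_rfl f j₁ j₂ j₃) :
    IsGluingOfThree j₁ (specMap surfaceZeroToPlane ≫ j₂) j₃
      (principalOpenIncl (MvPolynomial.X 1)) (specMap overlapFirstMiddleTwo)
      (specMap overlapLastMiddleTwo) (principalOpenIncl (MvPolynomial.X 1))
      (principalOpenIncl (MvPolynomial.X 0 * MvPolynomial.X 1)) (specMap (overlapFirstLast 2)) := by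
  have h' := h.isGluing
  have := isIso_surfaceZeroToPlane
  have := h.isOpenImmersion₂
  exact
  { isOpenImmersion₁ := h'.isOpenImmersion₁
    isOpenImmersion₂ := inferInstance
    isOpenImmersion₃ := h'.isOpenImmersion₃
    cover := fun x => (h'.cover x).imp_right (Or.imp_left (by
      rintro ⟨u, rfl⟩
      obtain ⟨v, rfl⟩ := (specMap surfaceZeroToPlane).surjective u
      exact ⟨v, Scheme.Hom.comp_apply _ _ _⟩))
    overlap₁₂ := isPullback_comp_surfaceZeroToPlane (by
      rw [← specMap_comp, overlapFirstMiddleTwo_comp_surfaceZeroToPlane]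
      exact h'.overlap₁₂)
    overlap₂₃ := (isPullback_comp_surfaceZeroToPlane (by
      rw [← specMap_comp, overlapLastMiddleTwo_comp_surfaceZeroToPlane]
      exact h'.overlap₂₃.flip)).flip
    overlap₁₃ := h'.overlap₁₃ }

end ASing
end

noncomputable section

namespace ASing

/-! ### The case of `A₁` -/

/-- `X` is covered by the two charts of the blow-up of `A₁`, compatibly with the overlap. -/
structure IsCoveredByTwo {X : Scheme.{0}} (f : X ⟶ Surface 1) (j₁ j₂ : Plane ⟶ X) : Prop where
  isOpenImmersion₁ : IsOpenImmersion j₁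
  isOpenImmersion₂ : IsOpenImmersion j₂
  comp₁ : j₁ ≫ f = specMap (chartFirst 1)
  comp₂ : j₂ ≫ f = specMap (chartLast 1)
  cover : ∀ x : X, x ∈ Set.range j₁ ∨ x ∈ Set.range j₂
  glue : specMap (planeAwayMap (MvPolynomial.X 1)) ≫ j₁ = specMap overlapFirstLastOne ≫ j₂

theorem IsCoveredByTwo.comp_iso {X Y : Scheme.{0}} {f : X ⟶ Surface 1} {j₁ j₂ : Plane ⟶ X}
    (h : IsCoveredByTwo f j₁ j₂) (e : X ≅ Y) {g : Y ⟶ Surface 1} (he : e.hom ≫ g = f) :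
    IsCoveredByTwo g (j₁ ≫ e.hom) (j₂ ≫ e.hom) where
  isOpenImmersion₁ := have := h.isOpenImmersion₁; inferInstance
  isOpenImmersion₂ := have := h.isOpenImmersion₂; inferInstance
  comp₁ := by rw [Category.assoc, he, h.comp₁]
  comp₂ := by rw [Category.assoc, he, h.comp₂]
  cover y := (h.cover (e.inv y)).imp (mem_range_comp_iso e) (mem_range_comp_iso e)
  glue := by rw [← Category.assoc, h.glue, Category.assoc]

theorem IsCoveredByTwo.isGluing {X : Scheme.{0}} {f : X ⟶ Surface 1} {j₁ j₂ : Plane ⟶ X}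
    (h : IsCoveredByTwo f j₁ j₂) :
    IsGluingOfTwo j₁ j₂ (principalOpenIncl (MvPolynomial.X 1)) (specMap overlapFirstLastOne) := by
  have := h.isOpenImmersion₁
  have := h.isOpenImmersion₂
  have := isDomain_planeAway (MvPolynomial.X_ne_zero (R := ℂ) (1 : Fin 2))
  exact
  { isOpenImmersion₁ := inferInstance
    isOpenImmersion₂ := inferInstance
    cover := h.cover
    overlap := separatedBy_first_last_one.isPullback (chartFirst_coord_ne_zero 0)
      h.comp₁ h.comp₂ h.glue }

/-- The charts of the blow-up for `n = 1`. -/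
def twoCharts : Fin 2 → Chart 1
  | 0 => Chart.mk _ (chartFirst 1)
  | 1 => Chart.mk _ (chartLast 1)

theorem IsCoveredByTwo.isDerBlowUp {X : Scheme.{0}} [AlgebraicGeometry.IsIntegral X]
    {f : X ⟶ Surface 1} {j₁ j₂ : Plane ⟶ X} (h : IsCoveredByTwo f j₁ j₂) : IsDerBlowUp 1 f := by
  let j : ∀ i, (twoCharts i).scheme ⟶ X := fun i => match i with
    | 0 => j₁
    | 1 => j₂
  have s : Chart.Overlap (j 0) (j 1) := ⟨_, _, _, _, _, separatedBy_first_last_one, h.glue⟩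
  have ho : ∀ i, IsOpenImmersion (j i) := by
    intro i
    fin_cases i
    exacts [h.isOpenImmersion₁, h.isOpenImmersion₂]
  refine isDerBlowUp_of_charts le_rfl f twoCharts j ?_ ?_ ?_ ?_ ?_
  · intro i
    fin_cases i
    exacts [h.comp₁, h.comp₂]
  · intro x
    rcases h.cover x with hx | hx
    exacts [⟨0, hx⟩, ⟨1, hx⟩]
  · intro i k
    fin_cases i <;> fin_cases k
    exacts [Chart.overlap_self _ (separatedBy_first_first le_rfl), s, s.symm,
      Chart.overlap_self _ (separatedBy_last_last le_rfl)]
  · intro i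
    fin_cases i
    exacts [isFree_chartFirst le_rfl, isFree_chartLast le_rfl]
  · intro Z _ σ hσ z
    obtain ⟨U, hz, ⟨l, hl⟩ | ⟨l, hl⟩ | ⟨hn, -⟩⟩ := exists_local_lift le_rfl hσ z
    · exact ⟨U, hz, 0, l, hl⟩
    · exact ⟨U, hz, 1, l, hl⟩
    · omega

theorem exists_isCoveredByTwo :
    ∃ (X : Scheme.{0}) (f : X ⟶ Surface 1) (j₁ j₂ : Plane ⟶ X),
      AlgebraicGeometry.IsIntegral X ∧ IsCoveredByTwo f j₁ j₂ := by
  have := isOpenImmersion_overlapFirstLastOne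
  have := isDomain_planeAway (MvPolynomial.X_ne_zero (R := ℂ) (1 : Fin 2))
  obtain ⟨X, f, j₁, j₂, hj₁, hj₂, hf₁, hf₂, hj, hX⟩ := exists_gluing_of_two
    (specMap (chartFirst 1)) (specMap (chartLast 1))
    (specMap (planeAwayMap (MvPolynomial.X 1))) (specMap overlapFirstLastOne) (by
      rw [← specMap_comp, ← specMap_comp, overlapFirstLastOne_comp_chartLast])
  exact ⟨X, f, j₁, j₂, isIntegral_of_two j₁ j₂ _ _ hj hX, hj₁, hj₂, hf₁, hf₂, hX, hj⟩

theorem IsDerBlowUp.exists_isCoveredByTwo {X : Scheme.{0}} {f : X ⟶ Surface 1}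
    (hf : IsDerBlowUp 1 f) : ∃ j₁ j₂ : Plane ⟶ X, IsCoveredByTwo f j₁ j₂ := by
  obtain ⟨Y, g, j₁, j₂, _, h⟩ := ASing.exists_isCoveredByTwo
  obtain ⟨e, he⟩ := IsModuleBlowUp.exists_iso h.isDerBlowUp hf
  exact ⟨_, _, h.comp_iso e he⟩

/-! ### Smoothness -/

/-- Smoothness of a scheme covered by open planes. -/
theorem smooth_of_planes {n : ℕ} {X : Scheme.{0}} (f : X ⟶ Surface n)
    (h : ∀ x : X, ∃ (j : Plane ⟶ X) (c : SurfaceRing n →ₐ[ℂ] PlaneRing),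
      IsOpenImmersion j ∧ x ∈ Set.range j ∧ j ≫ f = specMap c) :
    AlgebraicGeometry.Smooth (f ≫ surfaceToBase n) := by
  choose j c hj hx hc using h
  let 𝒰 : X.OpenCover :=
    { I₀ := X
      X := fun _ => Plane
      f := j
      mem₀ := by
        rw [Scheme.presieve₀_mem_precoverage_iff]
        exact ⟨fun x => ⟨x, hx x⟩, hj⟩ }
  have : HasRingHomProperty @AlgebraicGeometry.Smooth.{0} RingHom.Smooth := inferInstance
  have : IsZariskiLocalAtSource @AlgebraicGeometry.Smooth.{0} :=
    HasRingHomProperty.instIsZariskiLocalAtSource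
  rw [IsZariskiLocalAtSource.iff_of_openCover (P := @AlgebraicGeometry.Smooth.{0}) 𝒰]
  intro x
  -- Since the charts are ℂ-algebra maps, the composite to the base is the structure morphism of the
  -- plane, and smoothness reduces to that of a polynomial ring.
  have h : j x ≫ f ≫ surfaceToBase n =
      Spec.map (CommRingCat.ofHom (algebraMap ℂ PlaneRing)) := by
    rw [← Category.assoc, hc, surfaceToBase, ← Spec.map_comp, ← CommRingCat.ofHom_comp]
    congr 2
    exact (c x).comp_algebraMap
  change AlgebraicGeometry.Smooth (j x ≫ f ≫ surfaceToBase n)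
  rw [h, HasRingHomProperty.Spec_iff (P := @AlgebraicGeometry.Smooth.{0}), CommRingCat.hom_ofHom,
    RingHom.smooth_algebraMap]
  exact ⟨inferInstance, inferInstance⟩

end ASing

end

/-! ### The blow-up for n ≥ 3, n = 2 and n = 1 -/

theorem mainTheorem8 :
    -- the blow-up of the derivations exists
    (∀ n : ℕ, 1 ≤ n → ∃ (X : Scheme.{0}) (f : X ⟶ ASing.Surface n), ASing.IsDerBlowUp n f) ∧
    -- `n ≥ 3`: it is glued from `ℂ²`, `A_{n-2}`, `ℂ²`
    (∀ (n : ℕ) (hn : 3 ≤ n) (X : Scheme.{0}) (f : X ⟶ ASing.Surface n), ASing.IsDerBlowUp n f →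
      ∃ (j₁ : ASing.Plane ⟶ X) (j₂ : ASing.Surface (n - 2) ⟶ X) (j₃ : ASing.Plane ⟶ X),
        j₁ ≫ f = ASing.specMap (ASing.chartFirst n) ∧
        j₂ ≫ f = ASing.specMap (ASing.chartMiddle n (le_trans (by norm_num) hn)) ∧
        j₃ ≫ f = ASing.specMap (ASing.chartLast n) ∧
        IsGluingOfThree j₁ j₂ j₃
          (ASing.principalOpenIncl (MvPolynomial.X 1))
          (ASing.specMap (ASing.overlapFirstMiddle n (le_trans (by norm_num) hn)))
          (ASing.specMap (ASing.overlapLastMiddle n (le_trans (by norm_num) hn)))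
          (ASing.principalOpenIncl (MvPolynomial.X 1))
          (ASing.principalOpenIncl (MvPolynomial.X 0 * MvPolynomial.X 1))
          (ASing.specMap (ASing.overlapFirstLast n))) ∧
    -- `n = 2`: it is glued from three copies of `ℂ²`
    (∀ (X : Scheme.{0}) (f : X ⟶ ASing.Surface 2), ASing.IsDerBlowUp 2 f →
      ∃ j₁ j₂ j₃ : ASing.Plane ⟶ X,
        j₁ ≫ f = ASing.specMap (ASing.chartFirst 2) ∧
        j₂ ≫ f = ASing.specMap ASing.chartMiddleTwo ∧
        j₃ ≫ f = ASing.specMap (ASing.chartLast 2) ∧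
        IsGluingOfThree j₁ j₂ j₃
          (ASing.principalOpenIncl (MvPolynomial.X 1)) (ASing.specMap ASing.overlapFirstMiddleTwo)
          (ASing.specMap ASing.overlapLastMiddleTwo) (ASing.principalOpenIncl (MvPolynomial.X 1))
          (ASing.principalOpenIncl (MvPolynomial.X 0 * MvPolynomial.X 1))
          (ASing.specMap (ASing.overlapFirstLast 2))) ∧
    -- `n = 1`: it is glued from two copies of `ℂ²`
    (∀ (X : Scheme.{0}) (f : X ⟶ ASing.Surface 1), ASing.IsDerBlowUp 1 f →
      ∃ j₁ j₂ : ASing.Plane ⟶ X,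
        j₁ ≫ f = ASing.specMap (ASing.chartFirst 1) ∧
        j₂ ≫ f = ASing.specMap (ASing.chartLast 1) ∧
        IsGluingOfTwo j₁ j₂
          (ASing.principalOpenIncl (MvPolynomial.X 1)) (ASing.specMap ASing.overlapFirstLastOne)) ∧
    -- for `n = 1, 2` it is smooth over `ℂ`
    (∀ n : ℕ, n = 1 ∨ n = 2 → ∀ (X : Scheme.{0}) (f : X ⟶ ASing.Surface n),
      ASing.IsDerBlowUp n f →
        AlgebraicGeometry.Smooth (f ≫ ASing.surfaceToBase n)) := by
  refine ⟨fun n hn => ?_, fun n hn X f hf => ?_, fun X f hf => ?_, fun X f hf => ?_, ?_⟩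
  · rcases hn.lt_or_eq with hn | rfl
    · exact ASing.exists_isDerBlowUp_of_two_le hn
    · obtain ⟨X, f, j₁, j₂, _, h⟩ := ASing.exists_isCoveredByTwo
      exact ⟨X, f, h.isDerBlowUp⟩
  · obtain ⟨j₁, j₂, j₃, h⟩ := hf.exists_isCoveredByThree (le_trans (by norm_num) hn)
    exact ⟨j₁, j₂, j₃, h.comp₁, h.comp₂, h.comp₃, h.isGluing⟩
  · obtain ⟨j₁, j₂, j₃, h⟩ := hf.exists_isCoveredByThree le_rfl
    refine ⟨j₁, _, j₃, h.comp₁, ?_, h.comp₃, h.isGluing_two⟩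
    rw [Category.assoc, h.comp₂, ← ASing.specMap_comp, ASing.surfaceZeroToPlane_comp_chartMiddle]
  · obtain ⟨j₁, j₂, h⟩ := hf.exists_isCoveredByTwo
    exact ⟨j₁, j₂, h.comp₁, h.comp₂, h.isGluing⟩
  · rintro n (rfl | rfl) X f hf
    · obtain ⟨j₁, j₂, h⟩ := hf.exists_isCoveredByTwo
      refine ASing.smooth_of_planes f fun x => ?_
      rcases h.cover x with hx | hx
      exacts [⟨j₁, _, h.isOpenImmersion₁, hx, h.comp₁⟩, ⟨j₂, _, h.isOpenImmersion₂, hx, h.comp₂⟩]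
    · obtain ⟨j₁, j₂, j₃, h⟩ := hf.exists_isCoveredByThree le_rfl
      have h' := h.isGluing_two
      refine ASing.smooth_of_planes f fun x => ?_
      rcases h'.cover x with hx | hx | hx
      · exact ⟨j₁, _, h.isOpenImmersion₁, hx, h.comp₁⟩
      · exact ⟨_, _, h'.isOpenImmersion₂, hx, by
          rw [Category.assoc, h.comp₂, ← ASing.specMap_comp]⟩
      · exact ⟨j₃, _, h.isOpenImmersion₃, hx, h.comp₃⟩
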